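/- Let $g\ge 0$ be an integer and let $M_g\simeq\mathbb{C}^{3g+1}$ be the affine space of matrices $$A(x)=\begin{pmatrix} v(x) & u(x)\\ w(x) & -v(x)\end{pmatrix},\quad u=x^g+\sum_{k<g}u_kx^k,\quad v=\sum_{k<g}v_kx^k,\quad w=x^{g+1}+\sum_{k\le g}w_kx^k,$$ with coordinates $u_k,v_k,w_k\in\mathbb{C}$. Equip $M_g$ with the Poisson bracket determined by $$\{u_i,u_j\}=\{v_i,v_j\}=0,\quad \{u_i,v_j\}=u_{i+j+1},\quad \{u_i,w_j\}=-2v_{i+j+1},$$ $$\{v_i,w_j\}=w_{i+j+1}-\delta_{0,j}u_i,\quad \{w_i,w_j\}=2(\delta_{0,j}v_i-\delta_{i,0}v_j),$$ where $u_g=w_{g+1}=1$ and all other coefficients outside the above ranges are $0$. Let $\mathbf{H}(A)=-\det A(x)=v(x)^2+u(x)w(x)=x^{2g+1}+\sum_{k=0}^{2g}h_k(A)x^k$, and let $D_k=\{\cdot,h_k\}$, for $0\le k\le g-1$, be the Hamiltonian vector fields of $h_0,\dots,h_{g-1}$. For a monic polynomial $h\in\mathbb{C}[x]$ of degree $2g+1$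 and an integer $i\ge 0$ put $$M_{g,i}(h)=\{A\in M_g \mid \mathbf{H}(A)=h,\ \dim\langle D_0|_A,\dots,D_{g-1}|_A\rangle=i\}.$$ Then every stratum of the fibre $M_g(h)=\mathbf{H}^{-1}(h)$, that is, every non-empty $M_{g,i}(h)$, is a (not necessarily irreducible) quasi-affine variety which is smooth and of dimension $i$. In detail: it is Zariski locally closed in $M_g$; with its reduced structure, its local ring at each of its points is a regular local ring of Krull dimension $i$; and its Krull dimension as a topological space for the Zariski topology is $i$. -/

import Mathlib

open Polynomial Topology

noncomputable section

/-! ### Classical quasi-affine varieties over the complex numbers -/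

namespace ClassicalVariety

variable {σ : Type*}

/-- The Zariski topology on the affine space `ℂ^σ`, induced from the prime spectrum of the
polynomial ring; `isClosed_zariski_iff` says that its closed sets are the zero loci. -/
@[reducible] def zariskiTopology (σ : Type*) : TopologicalSpace (σ → ℂ) :=
  TopologicalSpace.induced
    (MvPolynomial.pointToPoint : (σ → ℂ) → PrimeSpectrum (MvPolynomial σ ℂ)) inferInstance

theorem isClosed_zariski_iff (Z : Set (σ → ℂ)) :
    IsClosed[zariskiTopology σ] Z ↔
      ∃ I : Ideal (MvPolynomial σ ℂ), Z = MvPolynomial.zeroLocus ℂ I := by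
  have key : ∀ s : Set (MvPolynomial σ ℂ),
      (MvPolynomial.pointToPoint : (σ → ℂ) → PrimeSpectrum (MvPolynomial σ ℂ)) ⁻¹'
        PrimeSpectrum.zeroLocus s = {x | ∀ p ∈ s, MvPolynomial.aeval x p = 0} := by
    intro s
    ext x
    simp only [Set.mem_preimage, PrimeSpectrum.mem_zeroLocus, Set.mem_ofPred_eq]
    exact ⟨fun h p hp => h hp x rfl,
      fun h p hp => (MvPolynomial.mem_vanishingIdeal_singleton_iff x p).2 (h p hp)⟩
  unfold zariskiTopology
  rw [isClosed_induced_iff]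
  constructor
  · rintro ⟨t, ht, rfl⟩
    obtain ⟨s, rfl⟩ := (PrimeSpectrum.isClosed_iff_zeroLocus t).1 ht
    exact ⟨Ideal.span s, by rw [key, MvPolynomial.zeroLocus_span]⟩
  · rintro ⟨I, rfl⟩
    exact ⟨PrimeSpectrum.zeroLocus (I : Set (MvPolynomial σ ℂ)),
      PrimeSpectrum.isClosed_zeroLocus _, by rw [key]; rfl⟩

/-- A quasi-affine variety (not assumed irreducible): a Zariski locally closed subset of an
affine space. -/
def IsQuasiAffine (S : Set (σ → ℂ)) : Prop :=
  @IsLocallyClosed _ (zariskiTopology σ) S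

/-- The dimension of `S`: the Krull dimension of `S` with the topology induced by the Zariski
topology. The empty set has dimension `⊥`. -/
def dimension (S : Set (σ → ℂ)) : WithBot ℕ∞ :=
  @topologicalKrullDim S
    (TopologicalSpace.induced (Subtype.val : S → (σ → ℂ)) (zariskiTopology σ))

/-- The local ring at `p` of the affine space `ℂ^σ`. -/
abbrev AffineLocalRing (p : σ → ℂ) : Type _ :=
  Localization.AtPrime (MvPolynomial.vanishingIdeal ℂ {p} : Ideal (MvPolynomial σ ℂ))

/-- The local ring at `p` of the quasi-affine variety `S` with its reduced structure: the local
ring of the affine space at `p` modulo the polynomials that vanish on `S`. -/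
abbrev LocalRing (S : Set (σ → ℂ)) (p : σ → ℂ) : Type _ :=
  AffineLocalRing p ⧸
    (MvPolynomial.vanishingIdeal ℂ S).map (algebraMap (MvPolynomial σ ℂ) (AffineLocalRing p))

/-- A quasi-affine variety is smooth if its local ring at each of its points is regular. -/
def IsSmooth (S : Set (σ → ℂ)) : Prop :=
  ∀ p ∈ S, IsRegularLocalRing (LocalRing S p)

/-- `S` has dimension `d` at each of its points. -/
def IsEquidimensional (S : Set (σ → ℂ)) (d : ℕ) : Prop :=
  ∀ p ∈ S, ringKrullDim (LocalRing S p) = d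

end ClassicalVariety

/-! ### The Mumford system of order `g` -/

namespace Mumford

variable (g : ℕ)

/-- Index set of the `3g+1` coordinates of the phase space. -/
abbrev Coord : Type := Fin g ⊕ Fin g ⊕ Fin (g + 1)

/-- The phase space `M_g`, identified with the affine space `ℂ^{3g+1}`. -/
abbrev PhaseSpace : Type := Coord g → ℂ

section LaxMatrix

variable {R : Type*} [CommRing R]

/-- `u(x) = x^g + u_{g-1} x^{g-1} + ⋯ + u_0`. -/
def uPoly (c : Coord g → R) : R[X] := X ^ g + ∑ i : Fin g, C (c (.inl i)) * X ^ (i : ℕ)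

/-- `v(x) = v_{g-1} x^{g-1} + ⋯ + v_0`. -/
def vPoly (c : Coord g → R) : R[X] := ∑ i : Fin g, C (c (.inr (.inl i))) * X ^ (i : ℕ)

/-- `w(x) = x^{g+1} + w_g x^g + ⋯ + w_0`. -/
def wPoly (c : Coord g → R) : R[X] :=
  X ^ (g + 1) + ∑ i : Fin (g + 1), C (c (.inr (.inr i))) * X ^ (i : ℕ)

/-- The matrix `A(x)` with coordinates `c`. -/
def laxMatrix (c : Coord g → R) : Matrix (Fin 2) (Fin 2) R[X] :=
  !![vPoly g c, uPoly g c; wPoly g c, -vPoly g c]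

/-- The moment map `H(A) = -det A(x) = v(x)² + u(x) w(x)`. -/
def momentMap (c : Coord g → R) : R[X] := -(laxMatrix g c).det

end LaxMatrix

/-- The fibre `M_g(h)` of the moment map. -/
def fiber (h : ℂ[X]) : Set (PhaseSpace g) := {A | momentMap g A = h}

/-- The algebra of polynomial functions on `M_g`. -/
abbrev Functions : Type := MvPolynomial (Coord g) ℂ

/-- The coordinate function `u_k` for `k < g`, extended by `u_g = 1` and `u_k = 0` for `k > g`. -/
def uCoef (k : ℕ) : Functions g := (uPoly g MvPolynomial.X).coeff k

/-- The coordinate function `v_k` for `k < g`, extended by `v_k = 0` for `k ≥ g`. -/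
def vCoef (k : ℕ) : Functions g := (vPoly g MvPolynomial.X).coeff k

/-- The coordinate function `w_k` for `k ≤ g`, extended by `w_{g+1} = 1` and `w_k = 0` for
`k > g + 1`. -/
def wCoef (k : ℕ) : Functions g := (wPoly g MvPolynomial.X).coeff k

/-- The brackets of the coordinate functions:
`{u_i,u_j} = {v_i,v_j} = 0`, `{u_i,v_j} = u_{i+j+1}`, `{u_i,w_j} = -2 v_{i+j+1}`,
`{v_i,w_j} = w_{i+j+1} - δ_{0,j} u_i`, `{w_i,w_j} = 2 (δ_{0,j} v_i - δ_{i,0} v_j)`. -/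
def coordBracket : Coord g → Coord g → Functions g
  | .inl _, .inl _ => 0
  | .inl i, .inr (.inl j) => uCoef g (i + j + 1)
  | .inr (.inl i), .inl j => -uCoef g (j + i + 1)
  | .inl i, .inr (.inr j) => -2 * vCoef g (i + j + 1)
  | .inr (.inr i), .inl j => 2 * vCoef g (j + i + 1)
  | .inr (.inl _), .inr (.inl _) => 0
  | .inr (.inl i), .inr (.inr j) => wCoef g (i + j + 1) - if j = 0 then uCoef g i else 0
  | .inr (.inr i), .inr (.inl j) => -(wCoef g (j + i + 1) - if i = 0 then uCoef g j else 0)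
  | .inr (.inr i), .inr (.inr j) =>
      2 * ((if j = 0 then vCoef g i else 0) - if i = 0 then vCoef g j else 0)

/-- The Poisson bracket on `M_g`: the biderivation with the given brackets of coordinates. -/
def poissonBracket (F G : Functions g) : Functions g :=
  ∑ a, ∑ b, coordBracket g a b * MvPolynomial.pderiv a F * MvPolynomial.pderiv b G

/-- The function `h_i` on `M_g`: the coefficient of `x^i` in the moment map. -/
def hamiltonian (i : ℕ) : Functions g := (momentMap g MvPolynomial.X).coeff i

/-- The value at `A` of the Hamiltonian vector field `D_i = {·, h_i}`, in coordinates. -/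
def vectorField (i : ℕ) (A : PhaseSpace g) : Coord g → ℂ := fun a =>
  MvPolynomial.eval A (poissonBracket g (MvPolynomial.X a) (hamiltonian g i))

/-- The stratum `M_{g,i}`: the points where `D_0, …, D_{g-1}` span a space of dimension `i`. -/
def stratum (i : ℕ) : Set (PhaseSpace g) :=
  {A | Module.finrank ℂ (Submodule.span ℂ (Set.range fun k : Fin g => vectorField g k A)) = i}

/-- The stratum `M_{g,i}(h) = M_g(h) ∩ M_{g,i}` of the fibre `M_g(h)`. -/
def fiberStratum (i : ℕ) (h : ℂ[X]) : Set (PhaseSpace g) := fiber g h ∩ stratum g i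

end Mumford

end

/-!
The rank of `D_0, …, D_{g-1}` at `A` is `g - deg Q`, where `Q` is the monic greatest common divisor
of `u`, `v` and `w`: up to a linear change of basis the `D_k` have the Bezoutians of these
polynomials as entries, and a linear relation between the fields is a polynomial `c` for which the
class of `Q c` modulo `x ^ g` has degree less than `deg Q`. Since `Q ^ 2` divides `H(A) = h` and `h`
has only finitely many monic divisors, the strata of a fibre are locally closed, and near `A` the
stratum of `A` is given by the conditions that `Q` divide `u`, `v`, `w` and that `H = h`. Written as
the vanishing of the remainders of `u`, `v`, `w` modulo `Q` and of the quotient `(H - h) / Q ^ 2`,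
these are `3 deg Q + 2 i + 1 = 3 g + 1 - i` equations, and they have independent differentials at
`A` because `u / Q`, `v / Q` and `w / Q` generate the unit ideal. The Jacobian criterion gives
regularity and the dimension of the local rings, and the Krull dimension of a quasi-affine variety
is the supremum of the dimensions of its local rings.
-/

noncomputable section

/-! ### Regular local rings -/

section RegularLocalRing

open IsLocalRing

variable {A : Type*} [CommRing A] [IsLocalRing A] [IsNoetherianRing A]

theorem exists_ringKrullDim_eq_natCast (A : Type*) [CommRing A] [IsLocalRing A]
    [IsNoetherianRing A] : ∃ n : ℕ, ringKrullDim A = n := by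
  obtain ⟨d, hd⟩ := WithBot.ne_bot_iff_exists.1 (ringKrullDim_ne_bot (R := A))
  obtain ⟨n, rfl⟩ := ENat.ne_top_iff_exists.1
    fun h : d = ⊤ => ringKrullDim_ne_top (R := A) (by rw [← hd, h]; rfl)
  exact ⟨n, hd.symm⟩

theorem exists_maximalIdeal_eq_span_sup_span {ι : Type*} [Fintype ι] {f : ι → maximalIdeal A}
    (hf : LinearIndependent (ResidueField A) fun j => (maximalIdeal A).toCotangent (f j)) :
    ∃ (n : ℕ) (t : Fin n → A),
      Fintype.card ι + n = Module.finrank (ResidueField A) (CotangentSpace A) ∧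
      maximalIdeal A = Ideal.span (Set.range fun j => (f j : A)) ⊔ Ideal.span (Set.range t) := by
  let V := Submodule.span (ResidueField A) (Set.range fun j => (maximalIdeal A).toCotangent (f j))
  obtain ⟨W, hVW⟩ := V.exists_isCompl
  let b := Module.finBasis (ResidueField A) W
  choose t ht using fun k => (maximalIdeal A).toCotangent_surjective (b k : CotangentSpace A)
  have hW : Submodule.span (ResidueField A) (Set.range ((maximalIdeal A).toCotangent ∘ t)) = W := by
    have h := congrArg (Submodule.map W.subtype) b.span_eq
    rw [Submodule.map_span, ← Set.range_comp, Submodule.map_subtype_top] at h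
    rwa [show (maximalIdeal A).toCotangent ∘ t = W.subtype ∘ b from funext ht]
  have hspan : Submodule.span A (Set.range f ∪ Set.range t) = ⊤ := by
    rw [← CotangentSpace.span_image_eq_top_iff, Set.image_union, ← Set.range_comp, ← Set.range_comp,
      Submodule.span_union, hW]
    exact hVW.sup_eq_top
  refine ⟨_, fun k => t k, ?_, ?_⟩
  · rw [← finrank_span_eq_card hf, Submodule.finrank_add_eq_of_isCompl hVW]
  · have h := congrArg (Submodule.map (maximalIdeal A).subtype) hspan
    rw [Submodule.map_span, Set.image_union, Submodule.map_subtype_top, Submodule.span_union,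
      ← Set.range_comp, ← Set.range_comp] at h
    exact h.symm

theorem spanFinrank_map_maximalIdeal_add_card_le {ι : Type*} [Fintype ι] {f : ι → maximalIdeal A}
    (hf : LinearIndependent (ResidueField A) fun j => (maximalIdeal A).toCotangent (f j)) :
    ((maximalIdeal A).map
        (Ideal.Quotient.mk (Ideal.span (Set.range fun j => (f j : A))))).spanFinrank +
      Fintype.card ι ≤ Module.finrank (ResidueField A) (CotangentSpace A) := by
  obtain ⟨n, t, hn, ht⟩ := exists_maximalIdeal_eq_span_sup_span hf
  set π := Ideal.Quotient.mk (Ideal.span (Set.range fun j => (f j : A)))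
  have hmap : (maximalIdeal A).map π = Ideal.span (Set.range (π ∘ t)) := by
    refine (congrArg (Ideal.map π) ht).trans ?_
    rw [Ideal.map_sup, Ideal.map_quotient_self, bot_sup_eq, Ideal.map_span, Set.range_comp]
  have hrank : ((maximalIdeal A).map π).spanFinrank ≤ n := by
    rw [hmap]
    refine (Submodule.spanFinrank_span_le_ncard_of_finite (Set.finite_range _)).trans ?_
    simpa using Finite.card_range_le (π ∘ t)
  omega

theorem isRegularLocalRing_quotient_span_range {A : Type*} [CommRing A] [IsRegularLocalRing A]
    {ι : Type*} [Fintype ι] {f : ι → maximalIdeal A}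
    (hf : LinearIndependent (ResidueField A) fun j => (maximalIdeal A).toCotangent (f j)) :
    IsRegularLocalRing (A ⧸ Ideal.span (Set.range fun j => (f j : A))) ∧
      ringKrullDim (A ⧸ Ideal.span (Set.range fun j => (f j : A))) + Fintype.card ι =
        ringKrullDim A := by
  have hge := spanFinrank_map_maximalIdeal_add_card_le hf
  set s := Set.range fun j => (f j : A) with hs
  have hsm : s ⊆ maximalIdeal A := by rintro _ ⟨j, rfl⟩; exact (f j).2
  have : Nontrivial (A ⧸ Ideal.span s) := Ideal.Quotient.nontrivial_iff.2
    (ne_top_of_le_ne_top (maximalIdeal.isMaximal A).ne_top (Ideal.span_le.2 hsm))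
  have : IsLocalRing (A ⧸ Ideal.span s) :=
    .of_surjective' (Ideal.Quotient.mk _) Ideal.Quotient.mk_surjective
  rw [map_maximalIdeal_of_surjective _ Ideal.Quotient.mk_surjective] at hge
  have hle : ringKrullDim A ≤ ringKrullDim (A ⧸ Ideal.span s) + Fintype.card ι := by
    have hcard : s.encard ≤ Fintype.card ι := by
      rw [hs, ← Set.image_univ]
      simpa only [Set.encard_univ, ENat.card_eq_coe_fintype_card]
        using Set.encard_image_le (fun j => (f j : A)) Set.univ
    refine (ringKrullDim_le_ringKrullDim_quotient_add_encard s ?_).trans ?_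
    · rwa [ringJacobson_eq_maximalIdeal]
    · gcongr
      exact_mod_cast hcard
  have hdim := ringKrullDim_le_spanFinrank_maximalIdeal (A ⧸ Ideal.span s)
  have hA := (IsRegularLocalRing.iff_finrank_cotangentSpace A).1 ‹_›
  obtain ⟨m, hm⟩ := exists_ringKrullDim_eq_natCast (A ⧸ Ideal.span s)
  rw [← hA, hm] at hle
  rw [hm] at hdim
  norm_cast at hle hdim
  refine ⟨.of_spanFinrank_maximalIdeal_le _ ?_, ?_⟩
  · rw [hm]
    norm_cast
    omega
  · rw [hm, ← hA]
    norm_cast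
    omega

theorem eq_bot_of_le_span_singleton {P : Ideal A} [P.IsPrime] {x : A} (hx : x ∈ maximalIdeal A)
    (hP : P ≤ Ideal.span {x}) (hxP : x ∉ P) : P = ⊥ := by
  refine Submodule.eq_bot_of_le_smul_of_le_jacobson_bot (maximalIdeal A) P
    (IsNoetherian.noetherian _) ?_ (jacobson_eq_maximalIdeal ⊥ bot_ne_top).ge
  intro y hy
  obtain ⟨a, rfl⟩ := Ideal.mem_span_singleton'.1 (hP hy)
  have ha : a ∈ P := (Ideal.IsPrime.mem_or_mem ‹_› hy).resolve_right hxP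
  rw [mul_comm]
  exact Submodule.smul_mem_smul hx ha

theorem exists_mem_maximalIdeal_notMem_sq_notMem_minimalPrimes
    (h : ringKrullDim A ≠ 0) :
    ∃ x ∈ maximalIdeal A, x ∉ maximalIdeal A ^ 2 ∧ ∀ P ∈ minimalPrimes A, x ∉ P := by
  by_contra! hcon
  have hcover : (maximalIdeal A : Set A) ⊆
      ⋃ I ∈ insert (maximalIdeal A ^ 2) (minimalPrimes A), (I : Set A) := by
    intro x hx
    by_cases hx2 : x ∈ maximalIdeal A ^ 2
    · exact Set.mem_biUnion (Set.mem_insert _ _) hx2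
    · obtain ⟨P, hP, hxP⟩ := hcon x hx hx2
      exact Set.mem_biUnion (Set.mem_insert_of_mem _ hP) hxP
  have hfin := (minimalPrimes.finite_of_isNoetherianRing A).insert (maximalIdeal A ^ 2)
  obtain ⟨P, hP | hP, hle⟩ := (Ideal.subset_union_prime_finite (f := id) hfin
    (maximalIdeal A ^ 2) (maximalIdeal A ^ 2)
    fun P hP hne _ => (hP.resolve_left hne).1.1).1 hcover
  · have hbot : maximalIdeal A = ⊥ := by
      refine Submodule.eq_bot_of_le_smul_of_le_jacobson_bot (maximalIdeal A) _
        (IsNoetherian.noetherian _) ?_ (jacobson_eq_maximalIdeal ⊥ bot_ne_top).ge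
      rwa [smul_eq_mul, ← pow_two, ← hP]
    exact h (ringKrullDim_eq_zero_of_isField (isField_iff_maximalIdeal_eq.2 hbot))
  · have hm : maximalIdeal A = P :=
      (maximalIdeal.isMaximal A).eq_of_le hP.1.1.ne_top hle
    have hheight : (maximalIdeal A).height = 0 := Ideal.height_eq_zero_iff.2 (hm ▸ hP)
    exact h (by rw [← maximalIdeal_height_eq_ringKrullDim, hheight]; rfl)

theorem linearIndependent_toCotangent_of_notMem_sq {A : Type*} [CommRing A] [IsLocalRing A]
    {x : maximalIdeal A} (hx : (x : A) ∉ maximalIdeal A ^ 2) :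
    LinearIndependent (ResidueField A) fun _ : Unit => (maximalIdeal A).toCotangent x := by
  rw [linearIndependent_unique_iff]
  exact fun h => hx ((Ideal.toCotangent_eq_zero _ _).1 h)

theorem isDomain_of_isRegularLocalRing (A : Type*) [CommRing A] [IsRegularLocalRing A] :
    IsDomain A := by
  obtain ⟨n, hn⟩ := exists_ringKrullDim_eq_natCast A
  induction n generalizing A with
  | zero =>
    have hrank := IsRegularLocalRing.spanFinrank_maximalIdeal (R := A)
    rw [hn] at hrank
    have hbot : maximalIdeal A = ⊥ := (Submodule.spanFinrank_eq_zero_iff_eq_bot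
      (maximalIdeal A).fg_of_isNoetherianRing).1 (by exact_mod_cast hrank)
    exact (isField_iff_maximalIdeal_eq.2 hbot).isDomain
  | succ n ih =>
    obtain ⟨x, hxm, hx2, hxmin⟩ := exists_mem_maximalIdeal_notMem_sq_notMem_minimalPrimes (A := A)
      (by rw [hn]; norm_cast)
    obtain ⟨hreg, hdim⟩ := isRegularLocalRing_quotient_span_range
      (linearIndependent_toCotangent_of_notMem_sq (x := ⟨x, hxm⟩) hx2)
    rw [Set.range_const] at hreg hdim
    have hquot : IsDomain (A ⧸ Ideal.span {x}) := by
      refine ih _ ?_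
      obtain ⟨m, hm⟩ := exists_ringKrullDim_eq_natCast (A ⧸ Ideal.span {x})
      rw [hm, hn, Fintype.card_unit] at hdim
      rw [hm]
      norm_cast at hdim ⊢
      omega
    have hprime : (Ideal.span {x}).IsPrime := (Ideal.Quotient.isDomain_iff_prime _).1 hquot
    obtain ⟨P, hP, hPx⟩ := Ideal.exists_minimalPrimes_le (I := ⊥) (J := Ideal.span {x}) bot_le
    have hPprime : P.IsPrime := hP.1.1
    rw [eq_bot_of_le_span_singleton hxm hPx (hxmin P hP)] at hPprime
    exact IsDomain.of_bot_isPrime A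

end RegularLocalRing

/-! ### The Jacobian criterion with dual numbers -/

section DualEval

open TrivSqZeroExt

variable {σ R : Type*} [CommRing R]

/-- Evaluation at the point `p + ε δ` over the dual numbers: its second component is the derivative
at `p` in the direction `δ`. -/
def dualEval (p δ : σ → R) : MvPolynomial σ R →ₐ[R] DualNumber R :=
  MvPolynomial.aeval fun a => inl (p a) + inr (δ a)

theorem fst_dualEval (p δ : σ → R) (F : MvPolynomial σ R) :
    (dualEval p δ F).fst = MvPolynomial.eval p F := by
  have h : (fstHom R R R).comp (dualEval p δ) = MvPolynomial.aeval p := by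
    ext a
    simp [dualEval]
  rw [← MvPolynomial.aeval_eq_eval, ← h]
  rfl

theorem snd_dualEval [Fintype σ] (p δ : σ → R) (F : MvPolynomial σ R) :
    (dualEval p δ F).snd = ∑ a, δ a * MvPolynomial.eval p (MvPolynomial.pderiv a F) := by
  classical
  induction F using MvPolynomial.induction_on with
  | C c => simp [dualEval, algebraMap_eq_inl]
  | add F G hF hG => simp only [map_add, snd_add, hF, hG, mul_add, Finset.sum_add_distrib]
  | mul_X F b hF =>
    have hX : dualEval p δ (MvPolynomial.X b) = inl (p b) + inr (δ b) := by simp [dualEval]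
    rw [map_mul, snd_mul, hF, fst_dualEval, hX]
    simp [MvPolynomial.pderiv_X, Pi.single_apply, mul_add, Finset.sum_add_distrib, apply_ite,
      Finset.mul_sum, mul_comm, mul_left_comm]

end DualEval

namespace ClassicalVariety

open IsLocalRing MvPolynomial TrivSqZeroExt

variable {σ : Type*}

theorem mem_vanishingIdeal_singleton_iff_eval {p : σ → ℂ} {F : MvPolynomial σ ℂ} :
    F ∈ vanishingIdeal ℂ {p} ↔ eval p F = 0 := by
  rw [mem_vanishingIdeal_singleton_iff, aeval_eq_eval]

theorem isClosed_setOf_eval_eq_zero {ι : Type*} (f : ι → MvPolynomial σ ℂ) :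
    IsClosed[zariskiTopology σ] {x | ∀ j, eval x (f j) = 0} := by
  rw [isClosed_zariski_iff]
  refine ⟨Ideal.span (Set.range f), ?_⟩
  rw [zeroLocus_span]
  ext x
  simp only [Set.forall_mem_range, aeval_eq_eval]

theorem exists_eval_ne_zero_of_isOpen {U : Set (σ → ℂ)} (hU : IsOpen[zariskiTopology σ] U)
    {p : σ → ℂ} (hp : p ∈ U) :
    ∃ s : MvPolynomial σ ℂ, eval p s ≠ 0 ∧ ∀ x ∉ U, eval x s = 0 := by
  have hc : IsClosed[zariskiTopology σ] Uᶜ := by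
    let _ := zariskiTopology σ
    exact hU.isClosed_compl
  obtain ⟨I, hI⟩ := (isClosed_zariski_iff _).1 hc
  have hpI : p ∉ zeroLocus ℂ I := hI ▸ not_not_intro hp
  simp only [mem_zeroLocus_iff, not_forall] at hpI
  obtain ⟨s, hs, hps⟩ := hpI
  exact ⟨s, hps, fun x hx => (hI.le hx : x ∈ zeroLocus ℂ I) s hs⟩

section LocalRing

variable (p : σ → ℂ)

/-- The automorphism of the polynomial ring given by the translation of the affine space by `t`. -/
def translation (t : σ → ℂ) : MvPolynomial σ ℂ ≃ₐ[ℂ] MvPolynomial σ ℂ :=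
  AlgEquiv.ofAlgHom (MvPolynomial.aeval fun a => .X a + .C (t a))
    (MvPolynomial.aeval fun a => .X a - .C (t a))
    (by ext a; simp [MvPolynomial.algebraMap_eq]) (by ext a; simp [MvPolynomial.algebraMap_eq])

theorem height_vanishingIdeal_singleton_eq (q : σ → ℂ) :
    (vanishingIdeal ℂ {p} : Ideal (MvPolynomial σ ℂ)).height =
      (vanishingIdeal ℂ {q} : Ideal (MvPolynomial σ ℂ)).height := by
  rw [← RingEquiv.height_comap (translation fun a => q a - p a).toRingEquiv]
  congr 1
  ext F
  have h : (MvPolynomial.aeval p : MvPolynomial σ ℂ →ₐ[ℂ] ℂ).comp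
      (translation fun a => q a - p a).toAlgHom = MvPolynomial.aeval q := by
    ext a
    simp [translation]
  rw [Ideal.mem_comap, mem_vanishingIdeal_singleton_iff, mem_vanishingIdeal_singleton_iff, ← h]
  rfl

theorem ringKrullDim_affineLocalRing [Finite σ] :
    ringKrullDim (AffineLocalRing p) = Nat.card σ := by
  have hdim : ringKrullDim (MvPolynomial σ ℂ) = Nat.card σ := by simp
  have : FiniteRingKrullDim (MvPolynomial σ ℂ) := by
    rw [finiteRingKrullDim_iff_ne_bot_and_top, hdim]
    exact ⟨WithBot.coe_ne_bot, fun h => ENat.natCast_ne_top _ (WithBot.coe_injective h)⟩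
  obtain ⟨m, hm, hht⟩ := Ideal.exists_isMaximal_height (R := MvPolynomial σ ℂ)
  obtain ⟨q, rfl⟩ := isMaximal_iff_eq_vanishingIdeal_singleton.1 hm
  rw [IsLocalization.AtPrime.ringKrullDim_eq_height (vanishingIdeal ℂ {p}),
    height_vanishingIdeal_singleton_eq p q, hht, hdim]

variable {p}

theorem isUnit_algebraMap_affineLocalRing {s : MvPolynomial σ ℂ} (hs : eval p s ≠ 0) :
    IsUnit (algebraMap _ (AffineLocalRing p) s) :=
  IsLocalization.map_units (M := (vanishingIdeal ℂ {p}).primeCompl) (AffineLocalRing p)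
    ⟨s, mem_vanishingIdeal_singleton_iff_eval.not.2 hs⟩

theorem algebraMap_mem_maximalIdeal {F : MvPolynomial σ ℂ} (hF : eval p F = 0) :
    algebraMap _ (AffineLocalRing p) F ∈ maximalIdeal (AffineLocalRing p) := by
  rw [← Localization.AtPrime.map_eq_maximalIdeal]
  exact Ideal.mem_map_of_mem _ (mem_vanishingIdeal_singleton_iff_eval.2 hF)

variable (p) in
/-- The tangent vector `δ` at `p` as a point over the dual numbers of the spectrum of the local
ring at `p`. -/
def tangentHom (δ : σ → ℂ) : AffineLocalRing p →+* DualNumber ℂ :=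
  IsLocalization.lift (M := (vanishingIdeal ℂ {p} : Ideal (MvPolynomial σ ℂ)).primeCompl)
    (g := (dualEval p δ : MvPolynomial σ ℂ →+* DualNumber ℂ)) fun s => by
      rw [isUnit_iff_isUnit_fst]
      exact isUnit_iff_ne_zero.2 fun h =>
        s.2 (mem_vanishingIdeal_singleton_iff_eval.2 ((fst_dualEval p δ s).symm.trans h))

theorem tangentHom_algebraMap (δ : σ → ℂ) (F : MvPolynomial σ ℂ) :
    tangentHom p δ (algebraMap _ _ F) = dualEval p δ F :=
  IsLocalization.lift_eq _ F

theorem fst_tangentHom_eq_zero_iff {δ : σ → ℂ} {x : AffineLocalRing p} :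
    (tangentHom p δ x).fst = 0 ↔ x ∈ maximalIdeal (AffineLocalRing p) := by
  refine ⟨fun hx => ?_, fun hx => ?_⟩
  · rw [mem_maximalIdeal, mem_nonunits_iff]
    exact fun hu => (isUnit_iff_isUnit_fst.1 (hu.map (tangentHom p δ))).ne_zero hx
  · let residue : AffineLocalRing p →+* ℂ :=
      (fstHom ℂ ℂ ℂ : DualNumber ℂ →+* ℂ).comp (tangentHom p δ)
    have hker : maximalIdeal (AffineLocalRing p) ≤ RingHom.ker residue := by
      rw [← Localization.AtPrime.map_eq_maximalIdeal, Ideal.map_le_iff_le_comap]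
      intro F hF
      change (tangentHom p δ (algebraMap _ _ F)).fst = 0
      rw [tangentHom_algebraMap, fst_dualEval]
      exact mem_vanishingIdeal_singleton_iff_eval.1 hF
    exact hker hx

theorem snd_tangentHom_eq_zero_of_mem_sq (δ : σ → ℂ) {x : AffineLocalRing p}
    (hx : x ∈ maximalIdeal (AffineLocalRing p) ^ 2) : (tangentHom p δ x).snd = 0 := by
  rw [pow_two] at hx
  refine Submodule.mul_induction_on hx (fun y hy z hz => ?_) fun y z hy hz => ?_
  · rw [map_mul, snd_mul, fst_tangentHom_eq_zero_iff.2 hy, fst_tangentHom_eq_zero_iff.2 hz,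
      zero_smul, MulOpposite.op_zero, zero_smul, add_zero]
  · rw [map_add, snd_add, hy, hz, add_zero]

theorem linearIndependent_toCotangent_algebraMap {ι : Type*} [Finite ι]
    {f : ι → MvPolynomial σ ℂ} (hf : ∀ j, eval p (f j) = 0)
    (hjac : Function.Surjective fun (δ : σ → ℂ) j => (dualEval p δ (f j)).snd) :
    LinearIndependent (ResidueField (AffineLocalRing p)) fun j =>
      (maximalIdeal (AffineLocalRing p)).toCotangent
        ⟨algebraMap _ _ (f j), algebraMap_mem_maximalIdeal (hf j)⟩ := by
  classical
  cases nonempty_fintype ι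
  rw [Fintype.linearIndependent_iff]
  intro k hk j₀
  choose a ha using fun j => residue_surjective (k j)
  have hsq : ∑ j, a j * algebraMap _ (AffineLocalRing p) (f j) ∈
      maximalIdeal (AffineLocalRing p) ^ 2 := by
    simp only [← ha] at hk
    have h := (Ideal.toCotangent_eq_zero _ (∑ j, a j • (⟨algebraMap _ (AffineLocalRing p) (f j),
      algebraMap_mem_maximalIdeal (hf j)⟩ : maximalIdeal (AffineLocalRing p)))).1
      (by rw [map_sum, ← hk]; rfl)
    simpa only [AddSubmonoidClass.coe_finsetSum, Submodule.coe_smul, smul_eq_mul] using h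
  obtain ⟨δ, hδ⟩ := hjac (Pi.single j₀ 1)
  have hδ' : ∀ j, (dualEval p δ (f j)).snd = if j = j₀ then 1 else 0 := fun j => by
    rw [← Pi.single_apply, ← hδ]
  have h0 := snd_tangentHom_eq_zero_of_mem_sq δ hsq
  rw [← ha j₀, residue_eq_zero_iff, ← fst_tangentHom_eq_zero_iff (δ := δ)]
  rw [map_sum, snd_sum] at h0
  simpa [tangentHom_algebraMap, fst_dualEval, hf, hδ'] using h0

theorem map_vanishingIdeal_eq_map [Finite σ] {S U : Set (σ → ℂ)}
    (hU : IsOpen[zariskiTopology σ] U) (hpU : p ∈ U) {J : Ideal (MvPolynomial σ ℂ)}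
    (hS : ∀ x ∈ U, x ∈ S ↔ x ∈ zeroLocus ℂ J)
    (hJ : (J.map (algebraMap _ (AffineLocalRing p))).IsRadical) :
    (vanishingIdeal ℂ S).map (algebraMap _ (AffineLocalRing p)) =
      J.map (algebraMap _ (AffineLocalRing p)) := by
  obtain ⟨s, hsp, hsU⟩ := exists_eval_ne_zero_of_isOpen hU hpU
  have hunit := isUnit_algebraMap_affineLocalRing hsp
  apply le_antisymm <;> refine Ideal.map_le_iff_le_comap.2 fun F hF => ?_
  · have hrad : s * F ∈ J.radical := by
      rw [← vanishingIdeal_zeroLocus_eq_radical (K := ℂ)]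
      intro x hx
      rw [map_mul]
      by_cases hxU : x ∈ U
      · rw [hF x ((hS x hxU).2 hx), mul_zero]
      · rw [aeval_eq_eval, hsU x hxU, zero_mul]
    have h := hJ (Ideal.map_radical_le _ (Ideal.mem_map_of_mem _ hrad))
    rw [map_mul] at h
    exact (Ideal.unit_mul_mem_iff_mem _ hunit).1 h
  · have hmem : s * F ∈ vanishingIdeal ℂ S := fun x hx => by
      rw [map_mul]
      by_cases hxU : x ∈ U
      · rw [(hS x hxU).1 hx F hF, mul_zero]
      · rw [aeval_eq_eval, hsU x hxU, zero_mul]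
    have h := Ideal.mem_map_of_mem (algebraMap _ (AffineLocalRing p)) hmem
    rw [map_mul] at h
    exact (Ideal.unit_mul_mem_iff_mem _ hunit).1 h

theorem isRegularLocalRing_localRing_of_surjective [Fintype σ] {S U : Set (σ → ℂ)} (hpS : p ∈ S)
    (hU : IsOpen[zariskiTopology σ] U) (hpU : p ∈ U) {ι : Type*} [Fintype ι]
    {f : ι → MvPolynomial σ ℂ} (hS : ∀ x ∈ U, x ∈ S ↔ ∀ j, eval x (f j) = 0)
    (hjac : Function.Surjective fun (δ : σ → ℂ) j => (dualEval p δ (f j)).snd) :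
    IsRegularLocalRing (LocalRing S p) ∧
      ringKrullDim (LocalRing S p) + Fintype.card ι = Fintype.card σ := by
  obtain ⟨hreg, hdim⟩ := isRegularLocalRing_quotient_span_range
    (linearIndependent_toCotangent_algebraMap ((hS p hpU).1 hpS) hjac)
  have hdom := @isDomain_of_isRegularLocalRing _ _ hreg
  have hspan : (Ideal.span (Set.range f)).map (algebraMap _ (AffineLocalRing p)) =
      Ideal.span (Set.range fun j => algebraMap _ (AffineLocalRing p) (f j)) := by
    rw [Ideal.map_span, ← Set.range_comp]
    rfl
  have hmap := map_vanishingIdeal_eq_map hU hpU (J := Ideal.span (Set.range f))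
    (fun x hx => by
      rw [hS x hx, zeroLocus_span]
      simp only [Set.mem_ofPred_eq, Set.forall_mem_range, aeval_eq_eval])
    (by
      rw [hspan]
      exact ((Ideal.Quotient.isDomain_iff_prime _).1 hdom).isRadical)
  unfold LocalRing
  rw [hmap, hspan]
  rw [ringKrullDim_affineLocalRing, Nat.card_eq_fintype_card] at hdim
  exact ⟨hreg, hdim⟩

end LocalRing

end ClassicalVariety

/-! ### Dimension through local rings -/

section OrderOfPrimes

variable {R : Type*} [CommRing R]

theorem ringKrullDim_quotient_map_localization (m I : Ideal R) [m.IsPrime] :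
    ringKrullDim (Localization.AtPrime m ⧸ I.map (algebraMap R (Localization.AtPrime m))) =
      Order.krullDim {P : PrimeSpectrum R // I ≤ P.asIdeal ∧ P.asIdeal ≤ m} := by
  let e := IsLocalization.AtPrime.primeSpectrumOrderIso (Localization.AtPrime m) m
  have he : ∀ Q, I.map (algebraMap R (Localization.AtPrime m)) ≤ Q.asIdeal ↔
      I ≤ (e Q).1.asIdeal := fun Q => Ideal.map_le_iff_le_comap
  have hsymm : ∀ P (hP : P ∈ Set.Iic ⟨m, ‹_›⟩), (e (e.symm ⟨P, hP⟩) : PrimeSpectrum R) = P :=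
    fun P hP => congrArg Subtype.val (e.apply_symm_apply ⟨P, hP⟩)
  rw [ringKrullDim, Order.krullDim_eq_of_orderIso
    (Ideal.primeSpectrumQuotientOrderIsoZeroLocus _)]
  exact Order.krullDim_eq_of_orderIso
    { toFun := fun Q => ⟨e Q, (he Q).1 Q.2, (e Q).2⟩
      invFun := fun P => ⟨e.symm ⟨P, P.2.2⟩, (he _).2 (P.2.1.trans_eq (by rw [hsymm P.1 P.2.2]))⟩
      left_inv := fun Q => Subtype.ext (e.symm_apply_apply Q)
      right_inv := fun P => Subtype.ext (hsymm P.1 P.2.2)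
      map_rel_iff' := e.map_rel_iff }

end OrderOfPrimes

theorem isIrreducible_image_iff_of_isInducing {X Y : Type*} [TopologicalSpace X]
    [TopologicalSpace Y] {f : X → Y} (hf : IsInducing f) {s : Set X} :
    IsIrreducible (f '' s) ↔ IsIrreducible s := by
  refine ⟨fun h => ⟨Set.image_nonempty.1 h.1, ?_⟩, fun h => h.image f hf.continuous.continuousOn⟩
  rintro u v hu hv ⟨x, hxs, hxu⟩ ⟨y, hys, hyv⟩
  obtain ⟨u', hu', rfl⟩ := hf.isOpen_iff.1 hu
  obtain ⟨v', hv', rfl⟩ := hf.isOpen_iff.1 hv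
  obtain ⟨_, ⟨z, hz, rfl⟩, hzu, hzv⟩ := h.2 u' v' hu' hv' ⟨f x, ⟨x, hxs, rfl⟩, hxu⟩
    ⟨f y, ⟨y, hys, rfl⟩, hyv⟩
  exact ⟨z, hz, hzu, hzv⟩

namespace ClassicalVariety

open MvPolynomial TopologicalSpace

attribute [local instance] zariskiTopology

variable {σ : Type*} {S : Set (σ → ℂ)}

section Dimension

variable (S) in
/-- The points of `S` as points of the prime spectrum of the polynomial ring. -/
def toSpec (x : S) : PrimeSpectrum (MvPolynomial σ ℂ) :=
  pointToPoint (x : σ → ℂ)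

theorem isInducing_toSpec : IsInducing (toSpec S) :=
  IsInducing.comp ⟨rfl⟩ IsInducing.subtypeVal

theorem vanishingIdeal_image_toSpec (Z : Set S) :
    PrimeSpectrum.vanishingIdeal (toSpec S '' Z) = vanishingIdeal ℂ (Subtype.val '' Z) := by
  ext F
  rw [PrimeSpectrum.mem_vanishingIdeal, mem_vanishingIdeal_iff, Set.forall_mem_image,
    Set.forall_mem_image]
  exact forall₂_congr fun x _ => mem_vanishingIdeal_singleton_iff _ F

theorem isIrreducible_iff_isPrime_vanishingIdeal {Z : Set S} :
    IsIrreducible Z ↔ (vanishingIdeal ℂ (Subtype.val '' Z)).IsPrime := by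
  rw [← isIrreducible_image_iff_of_isInducing isInducing_toSpec,
    PrimeSpectrum.isIrreducible_iff_vanishingIdeal_isPrime, vanishingIdeal_image_toSpec]

/-- The prime ideal of an irreducible closed subset. -/
def primeIdealOf (Z : IrreducibleCloseds S) : PrimeSpectrum (MvPolynomial σ ℂ) :=
  ⟨vanishingIdeal ℂ (Subtype.val '' (Z : Set S)),
    isIrreducible_iff_isPrime_vanishingIdeal.1 Z.isIrreducible⟩

theorem primeIdealOf_le_primeIdealOf_iff {Z W : IrreducibleCloseds S} :
    primeIdealOf Z ≤ primeIdealOf W ↔ W ≤ Z := by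
  refine ⟨fun h => ?_, fun h => vanishingIdeal_anti_mono (Set.image_mono h)⟩
  have hclosure : ∀ Y : IrreducibleCloseds S,
      (Y : Set S) = toSpec S ⁻¹' PrimeSpectrum.zeroLocus (primeIdealOf Y).asIdeal := fun Y => by
    change _ = toSpec S ⁻¹' PrimeSpectrum.zeroLocus (vanishingIdeal ℂ (Subtype.val '' (Y : Set S)))
    rw [← vanishingIdeal_image_toSpec, PrimeSpectrum.zeroLocus_vanishingIdeal_eq_closure,
      ← isInducing_toSpec.closure_eq_preimage_closure_image, Y.isClosed.closure_eq]
  rw [← SetLike.coe_subset_coe, hclosure Z, hclosure W]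
  exact Set.preimage_mono (PrimeSpectrum.zeroLocus_anti_mono h)

variable (S) in
/-- The prime ideals that contain the ideal of `S` and are contained in the ideal of `p`: the
points of the spectrum of the local ring of `S` at `p`. -/
abbrev LocalPrimes (p : σ → ℂ) : Type _ :=
  {P : PrimeSpectrum (MvPolynomial σ ℂ) //
    vanishingIdeal ℂ S ≤ P.asIdeal ∧ P.asIdeal ≤ vanishingIdeal ℂ {p}}

theorem exists_inter_subset (hS : IsQuasiAffine S) {p : σ → ℂ} (hp : p ∈ S) :
    ∃ s : MvPolynomial σ ℂ, eval p s ≠ 0 ∧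
      ∀ x ∈ zeroLocus ℂ (vanishingIdeal ℂ S), eval x s ≠ 0 → x ∈ S := by
  obtain ⟨U, Z, hU, hZ, rfl⟩ := hS
  obtain ⟨s, hs, hsU⟩ := exists_eval_ne_zero_of_isOpen hU hp.1
  obtain ⟨I, rfl⟩ := (isClosed_zariski_iff _).1 hZ
  refine ⟨s, hs, fun x hx hxs => ⟨?_, ?_⟩⟩
  · by_contra hxU
    exact hxs (hsU x hxU)
  · exact fun F hF => hx F fun y hy => hy.2 F hF

theorem vanishingIdeal_zeroLocus_inter [Finite σ] (hS : IsQuasiAffine S) {p : σ → ℂ} (hp : p ∈ S)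
    (P : LocalPrimes S p) : vanishingIdeal ℂ (zeroLocus ℂ P.1.asIdeal ∩ S) = P.1.asIdeal := by
  obtain ⟨P, hSP, hPp⟩ := P
  obtain ⟨s, hsp, hs⟩ := exists_inter_subset hS hp
  refine le_antisymm (fun F hF => ?_) fun F hF x hx => hx.1 F hF
  have hsF : s * F ∈ P.asIdeal := by
    rw [← IsPrime.vanishingIdeal_zeroLocus (K := ℂ) P.asIdeal]
    intro x hx
    rw [map_mul]
    by_cases hxs : eval x s = 0
    · rw [aeval_eq_eval, hxs, zero_mul]
    · rw [hF x ⟨hx, hs x (zeroLocus_anti_mono hSP hx) hxs⟩, mul_zero]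
  exact (P.isPrime.mem_or_mem hsF).resolve_left fun hsP =>
    hsp (mem_vanishingIdeal_singleton_iff_eval.1 (hPp hsP))

theorem krullDim_localPrimes_le_dimension [Finite σ] (hS : IsQuasiAffine S) {p : σ → ℂ}
    (hp : p ∈ S) : Order.krullDim (LocalPrimes S p) ≤ dimension S := by
  have himage : ∀ P : LocalPrimes S p,
      Subtype.val '' (Subtype.val ⁻¹' zeroLocus ℂ P.1.asIdeal : Set S) =
        zeroLocus ℂ P.1.asIdeal ∩ S := fun P => by
    rw [Subtype.image_preimage_coe, Set.inter_comm]
  let locus : (LocalPrimes S p)ᵒᵈ → IrreducibleCloseds S := fun P =>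
    ⟨Subtype.val ⁻¹' zeroLocus ℂ P.ofDual.1.asIdeal,
      isIrreducible_iff_isPrime_vanishingIdeal.2 (by
        rw [himage, vanishingIdeal_zeroLocus_inter hS hp]
        exact P.ofDual.1.isPrime),
      ((isClosed_zariski_iff _).2 ⟨_, rfl⟩).preimage continuous_subtype_val⟩
  have hlocus : ∀ P, primeIdealOf (locus P) = P.ofDual.1 := fun P =>
    PrimeSpectrum.ext ((congrArg _ (himage _)).trans (vanishingIdeal_zeroLocus_inter hS hp _))
  rw [← Order.krullDim_orderDual]
  refine Order.krullDim_le_of_strictMono locus (strictMono_of_le_iff_le fun P Q => ?_)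
  rw [← primeIdealOf_le_primeIdealOf_iff, hlocus, hlocus]
  rfl

theorem krullDim_Ici_le_krullDim_localPrimes {Z : IrreducibleCloseds S} {p : S} (hp : p ∈ Z) :
    Order.krullDim (Set.Ici Z) ≤ Order.krullDim (LocalPrimes S p) := by
  rw [← Order.krullDim_orderDual (α := LocalPrimes S p)]
  refine Order.krullDim_le_of_strictMono
    (fun W => OrderDual.toDual (⟨primeIdealOf W.1, ?_, ?_⟩ : LocalPrimes S p))
    (strictMono_of_le_iff_le fun _ _ => primeIdealOf_le_primeIdealOf_iff.symm)
  · exact vanishingIdeal_anti_mono (Subtype.coe_image_subset S _)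
  · exact vanishingIdeal_anti_mono (Set.singleton_subset_iff.2 ⟨p, W.2 hp, rfl⟩)

theorem dimension_eq_iSup_ringKrullDim [Finite σ] (hS : IsQuasiAffine S) :
    dimension S = ⨆ p : S, ringKrullDim (LocalRing S (p : σ → ℂ)) := by
  simp only [ringKrullDim_quotient_map_localization]
  refine le_antisymm ?_ (iSup_le fun p => krullDim_localPrimes_le_dimension hS p.2)
  rw [dimension, topologicalKrullDim, Order.krullDim_eq_iSup_coheight]
  refine iSup_le fun Z => ?_
  obtain ⟨p, hp⟩ := Z.isIrreducible.nonempty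
  rw [Order.coheight_eq_krullDim_Ici]
  exact (krullDim_Ici_le_krullDim_localPrimes hp).trans
    (le_iSup (fun p : S => Order.krullDim (LocalPrimes S (p : σ → ℂ))) p)

theorem dimension_eq_of_isEquidimensional [Finite σ] (hS : IsQuasiAffine S) (hne : S.Nonempty)
    {d : ℕ} (hd : IsEquidimensional S d) : dimension S = d := by
  have := hne.to_subtype
  rw [dimension_eq_iSup_ringKrullDim hS, iSup_congr fun p : S => hd p p.2, ciSup_const]

end Dimension

end ClassicalVariety

/-! ### Division of polynomials over the dual numbers -/

section DualPolynomial

open TrivSqZeroExt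

variable {R : Type*} [CommRing R]

/-- The polynomial `a + ε b` over the dual numbers. -/
def dualPoly (a b : R[X]) : (DualNumber R)[X] :=
  a.map (inlHom R R) + C DualNumber.eps * b.map (inlHom R R)

theorem coeff_dualPoly (a b : R[X]) (n : ℕ) :
    (dualPoly a b).coeff n = inl (a.coeff n) + inr (b.coeff n) := by
  rw [dualPoly, coeff_add, coeff_C_mul, coeff_map, coeff_map]
  ext <;> simp [-DualNumber.inr_eq_smul_eps]

theorem dualPoly_add (a b c d : R[X]) :
    dualPoly a b + dualPoly c d = dualPoly (a + c) (b + d) := by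
  simp only [dualPoly, Polynomial.map_add]
  ring

theorem dualPoly_mul (a b c d : R[X]) :
    dualPoly a b * dualPoly c d = dualPoly (a * c) (a * d + b * c) := by
  have h : (C DualNumber.eps * C DualNumber.eps : (DualNumber R)[X]) = 0 := by
    rw [← C_mul, DualNumber.eps_mul_eps, C_0]
  simp only [dualPoly, Polynomial.map_add, Polynomial.map_mul]
  linear_combination (b.map (inlHom R R)) * (d.map (inlHom R R)) * h

theorem dualPoly_div_modByMonic (a b : R[X]) {q : R[X]} (hq : q.Monic) :
    dualPoly a b /ₘ q.map (inlHom R R) = dualPoly (a /ₘ q) (b /ₘ q) ∧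
      dualPoly a b %ₘ q.map (inlHom R R) = dualPoly (a %ₘ q) (b %ₘ q) := by
  rcases subsingleton_or_nontrivial R with _ | _
  · have : Subsingleton (DualNumber R) := inferInstanceAs (Subsingleton (R × R))
    exact ⟨Subsingleton.elim _ _, Subsingleton.elim _ _⟩
  have hdeg : ∀ r : R[X], (r %ₘ q).map (inlHom R R) ∈ degreeLT (DualNumber R) q.natDegree :=
    fun r => by
      rw [mem_degreeLT, ← degree_eq_natDegree hq.ne_zero]
      exact degree_map_le.trans_lt (degree_modByMonic_lt r hq)
  refine div_modByMonic_unique _ _ (hq.map _) ⟨?_, ?_⟩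
  · conv_rhs => rw [← modByMonic_add_div a q, ← modByMonic_add_div b q]
    simp only [dualPoly, Polynomial.map_add, Polynomial.map_mul]
    ring
  · rw [hq.degree_map, degree_eq_natDegree hq.ne_zero, ← mem_degreeLT, dualPoly, ← smul_eq_C_mul]
    exact add_mem (hdeg a) (Submodule.smul_mem _ _ (hdeg b))

end DualPolynomial

section Tail

variable {R : Type*} [CommRing R]

/-- The polynomial part of `p / X ^ k`. -/
def tail (k : ℕ) : R[X] →ₗ[R] R[X] :=
  ({ toFun := divX, map_add' := fun _ _ => divX_add, map_smul' := fun c p => by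
      rw [smul_eq_C_mul, divX_C_mul, RingHom.id_apply, smul_eq_C_mul] } : Module.End R R[X]) ^ k

@[simp] theorem coeff_tail (k : ℕ) (p : R[X]) (n : ℕ) : (tail k p).coeff n = p.coeff (n + k) := by
  induction k generalizing n with
  | zero => simp [tail]
  | succ k ih =>
    have hdivX : tail (k + 1) p = divX (tail k p) := by
      rw [tail, pow_succ']
      rfl
    rw [hdivX, coeff_divX, ih, add_assoc, add_comm 1 k]

theorem tail_mem_degreeLT {p : R[X]} {n k : ℕ} (hp : p.degree < (n + k : ℕ)) :
    tail k p ∈ degreeLT R n := by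
  rw [mem_degreeLT, degree_lt_iff_coeff_zero]
  rw [degree_lt_iff_coeff_zero] at hp
  exact fun m hm => by rw [coeff_tail, hp _ (Nat.add_le_add_right hm k)]

theorem tail_succ_mem_degreeLT {p : R[X]} {n : ℕ} (hp : p.degree ≤ n) (k : ℕ) :
    tail (k + 1) p ∈ degreeLT R n :=
  tail_mem_degreeLT (hp.trans_lt (by exact_mod_cast show n < n + (k + 1) by omega))

theorem tail_eq_zero_iff {p : R[X]} {k : ℕ} : tail k p = 0 ↔ p.degree < k := by
  refine ⟨fun h => ?_, fun h => ?_⟩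
  · rw [degree_lt_iff_coeff_zero]
    intro m hm
    rw [← Nat.sub_add_cancel hm, ← coeff_tail, h, coeff_zero]
  · ext n
    rw [coeff_tail, coeff_zero]
    exact coeff_eq_zero_of_degree_lt (h.trans_le (Nat.cast_le.2 (Nat.le_add_left k n)))

theorem tail_X_pow_mul (m k : ℕ) (p : R[X]) : tail (m + k) (X ^ m * p) = tail k p := by
  ext n
  rw [coeff_tail, coeff_tail, add_left_comm, add_comm m, coeff_X_pow_mul]

@[simp] theorem tail_zero (p : R[X]) : tail 0 p = p :=
  rfl

theorem tail_succ_X_mul (k : ℕ) (p : R[X]) : tail (k + 1) (X * p) = tail k p := by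
  rw [add_comm, ← tail_X_pow_mul 1 k, pow_one]

theorem coeff_mul_tail_add_coeff_mul_tail (p q : R[X]) (i k : ℕ) :
    (q * tail (i + 1) p).coeff k + (p * tail (k + 1) q).coeff i = (p * q).coeff (i + k + 1) := by
  simp only [coeff_mul, Finset.Nat.sum_antidiagonal_eq_sum_range_succ_mk, coeff_tail,
    Nat.succ_eq_add_one]
  rw [add_comm, show i + k + 1 + 1 = i + 1 + (k + 1) by ring, Finset.sum_range_add _ (i + 1),
    ← Finset.sum_range_reflect fun j => p.coeff (i + 1 + j) * q.coeff (i + k + 1 - (i + 1 + j))]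
  refine congrArg₂ _ (Finset.sum_congr rfl fun j hj => ?_) (Finset.sum_congr rfl fun j hj => ?_)
  all_goals rw [Finset.mem_range] at hj
  · rw [show i - j + (k + 1) = i + k + 1 - j by omega]
  · rw [mul_comm, show i + 1 + (k + 1 - 1 - j) = k - j + (i + 1) by omega,
      show i + k + 1 - (k - j + (i + 1)) = j by omega]

/-- Symmetry of the Bezoutian: for `p, q` of degree at most `n`, these are the coefficients of
`(p(y) q(x) - p(x) q(y)) / (y - x)`. -/
theorem coeff_mul_tail_sub_comm (p q : R[X]) (i k : ℕ) :
    (q * tail (i + 1) p - p * tail (i + 1) q).coeff k =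
      (q * tail (k + 1) p - p * tail (k + 1) q).coeff i := by
  have hpq := coeff_mul_tail_add_coeff_mul_tail p q i k
  have hqp := coeff_mul_tail_add_coeff_mul_tail q p i k
  rw [mul_comm q p] at hqp
  rw [coeff_sub, coeff_sub]
  linear_combination hpq - hqp

end Tail

section DualSum

open TrivSqZeroExt

variable {R : Type*} [CommRing R]

theorem sum_C_inl_add_inr_mul_X_pow {n : ℕ} (a b : Fin n → R) :
    ∑ i, C (inl (a i) + inr (b i) : DualNumber R) * X ^ (i : ℕ) =
      dualPoly (∑ i, C (a i) * X ^ (i : ℕ)) (∑ i, C (b i) * X ^ (i : ℕ)) := by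
  simp only [dualPoly, Polynomial.map_sum, Finset.mul_sum, ← Finset.sum_add_distrib]
  refine Finset.sum_congr rfl fun i _ => ?_
  have hinr : (inr (b i) : DualNumber R) = DualNumber.eps * inl (b i) := by ext <;> simp
  simp only [Polynomial.map_mul, Polynomial.map_pow, map_C, map_X, inlHom_apply, hinr, C_add, C_mul]
  ring

theorem X_pow_add_dualPoly (n : ℕ) (a b : R[X]) :
    X ^ n + dualPoly a b = dualPoly (X ^ n + a) b := by
  rw [dualPoly, dualPoly, Polynomial.map_add, Polynomial.map_pow, map_X, add_assoc]

theorem snd_dualEval_coeff {σ : Type*} {p δ : σ → R} {P : (MvPolynomial σ R)[X]} {a b : R[X]}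
    (h : P.map (dualEval p δ : MvPolynomial σ R →+* DualNumber R) = dualPoly a b) (n : ℕ) :
    (dualEval p δ (P.coeff n)).snd = b.coeff n := by
  have hn := congrArg (fun F => snd (F.coeff n)) h
  simpa only [coeff_map, RingHom.coe_coe, coeff_dualPoly, snd_add, snd_inl, snd_inr, zero_add]
    using hn

theorem sum_C_coeff_mul_X_pow {p : R[X]} {n : ℕ} (hp : p.degree < n) :
    ∑ i : Fin n, C (p.coeff i) * X ^ (i : ℕ) = p := by
  rw [sum_fin (fun i a => C a * X ^ i) (by simp) hp, sum_C_mul_X_pow_eq]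

end DualSum

section Bezoutian

variable {R : Type*} [CommRing R]

theorem degree_modByMonic_X_pow_lt [Nontrivial R] (k : ℕ) (p : R[X]) :
    (p %ₘ X ^ k).degree < k :=
  (degree_modByMonic_lt p (monic_X_pow k)).trans_eq (degree_X_pow k)

theorem X_pow_mul_tail_add_modByMonic [Nontrivial R] (k : ℕ) (p : R[X]) :
    X ^ k * tail k p + p %ₘ X ^ k = p := by
  have htail : tail k (p %ₘ X ^ k) = 0 := tail_eq_zero_iff.2 (degree_modByMonic_X_pow_lt k p)
  have hdiv : tail k p = p /ₘ X ^ k := by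
    conv_lhs => rw [← modByMonic_add_div p (X ^ k), map_add, htail, zero_add]
    exact tail_X_pow_mul k 0 _
  rw [hdiv, add_comm, modByMonic_add_div]

theorem X_mul_tail_succ (k : ℕ) (p : R[X]) : X * tail (k + 1) p + C (p.coeff k) = tail k p := by
  ext (_ | n)
  · simp
  · simp [add_right_comm n 1 k, add_assoc]

/-- The Bezoutian `(p(y) q(x) - p(x) q(y)) / (y - x)`, contracted with `c` in the variable `y`:
if `p` and `q` have degree at most `k`, then `y ^ i` is paired with the coefficient of
`X ^ (k - 1 - i)` in `c`. -/
def bezoutian (k : ℕ) (p q : R[X]) : R[X] →ₗ[R] R[X] :=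
  LinearMap.mulLeft R q ∘ₗ tail k ∘ₗ LinearMap.mulLeft R p -
    LinearMap.mulLeft R p ∘ₗ tail k ∘ₗ LinearMap.mulLeft R q

theorem bezoutian_apply (k : ℕ) (p q c : R[X]) :
    bezoutian k p q c = q * tail k (p * c) - p * tail k (q * c) :=
  rfl

theorem bezoutian_swap (k : ℕ) (p q c : R[X]) : bezoutian k q p c = -bezoutian k p q c := by
  rw [bezoutian_apply, bezoutian_apply, neg_sub]

theorem bezoutian_X_pow (m i : ℕ) (p q : R[X]) :
    bezoutian (m + i) p q (X ^ m) = q * tail i p - p * tail i q := by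
  rw [bezoutian_apply, mul_comm p, mul_comm q (X ^ m), tail_X_pow_mul, tail_X_pow_mul]

theorem degree_mul_lt_of_degree_le {p q : R[X]} {m n : ℕ} (hp : p.degree ≤ m) (hq : q.degree < n) :
    (p * q).degree < (m + n : ℕ) := by
  rcases eq_or_ne q 0 with rfl | hq0
  · rw [mul_zero, degree_zero]
    exact WithBot.bot_lt_coe _
  · refine (degree_mul_le p q).trans_lt ?_
    rw [degree_eq_natDegree hq0] at hq ⊢
    rw [Nat.cast_lt] at hq
    exact (add_le_add_left hp _).trans_lt (by exact_mod_cast Nat.add_lt_add_left hq m)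

theorem degree_bezoutian_lt [Nontrivial R] (k : ℕ) {n : ℕ} {p q : R[X]} (hp : p.degree ≤ n)
    (hq : q.degree ≤ n) (c : R[X]) : (bezoutian k p q c).degree < n := by
  have hX : X ^ k * bezoutian k p q c = p * (q * c %ₘ X ^ k) - q * (p * c %ₘ X ^ k) := by
    rw [bezoutian_apply]
    linear_combination q * X_pow_mul_tail_add_modByMonic k (p * c) -
      p * X_pow_mul_tail_add_modByMonic k (q * c)
  have hdeg : degree (X ^ k * bezoutian k p q c) < (n + k : ℕ) := by
    rw [hX]
    exact (degree_sub_le _ _).trans_lt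
      (max_lt
      (degree_mul_lt_of_degree_le hp (degree_modByMonic_X_pow_lt k _))
      (degree_mul_lt_of_degree_le hq (degree_modByMonic_X_pow_lt k _)))
  rw [degree_lt_iff_coeff_zero] at hdeg ⊢
  exact fun m hm => by rw [← coeff_X_pow_mul, hdeg _ (Nat.add_le_add_right hm k)]

end Bezoutian

namespace Mumford

variable (g : ℕ)

section Coordinates

variable {R S : Type*} [CommRing R] [CommRing S]

/-- The variation of `u(x)` along a tangent vector `c`; that of `v(x)` is `vPoly g c`. -/
def uTangent (c : Coord g → R) : R[X] := ∑ i : Fin g, C (c (.inl i)) * X ^ (i : ℕ)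

/-- The variation of `w(x)` along a tangent vector `c`. -/
def wTangent (c : Coord g → R) : R[X] := ∑ i : Fin (g + 1), C (c (.inr (.inr i))) * X ^ (i : ℕ)

/-- The tangent vector along which `u(x)`, `v(x)` and `w(x)` vary by `U`, `V` and `W`. The
coefficients of `U` and `V` from degree `g` on, and of `W` from degree `g + 1` on, are discarded. -/
def ofPoly (U V W : R[X]) : Coord g → R :=
  Sum.elim (fun i => U.coeff i) (Sum.elim (fun i => V.coeff i) fun i => W.coeff i)

variable {g} {U V W : R[X]}

theorem uTangent_ofPoly (hU : U ∈ degreeLT R g) : uTangent g (ofPoly g U V W) = U :=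
  sum_C_coeff_mul_X_pow (mem_degreeLT.1 hU)

theorem vPoly_ofPoly (hV : V ∈ degreeLT R g) : vPoly g (ofPoly g U V W) = V :=
  sum_C_coeff_mul_X_pow (mem_degreeLT.1 hV)

theorem wTangent_ofPoly (hW : W ∈ degreeLT R (g + 1)) : wTangent g (ofPoly g U V W) = W :=
  sum_C_coeff_mul_X_pow (mem_degreeLT.1 hW)

theorem ofPoly_eq_zero_iff (hU : U ∈ degreeLT R g) (hV : V ∈ degreeLT R g)
    (hW : W ∈ degreeLT R (g + 1)) : ofPoly g U V W = 0 ↔ U = 0 ∧ V = 0 ∧ W = 0 := by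
  refine ⟨fun h => ⟨?_, ?_, ?_⟩, ?_⟩
  · rw [← uTangent_ofPoly (V := V) (W := W) hU, h]
    simp [uTangent]
  · rw [← vPoly_ofPoly (U := U) (W := W) hV, h]
    simp [vPoly]
  · rw [← wTangent_ofPoly (U := U) (V := V) hW, h]
    simp [wTangent]
  · rintro ⟨rfl, rfl, rfl⟩
    ext (_ | _ | _) <;> simp [ofPoly]

variable (g)

theorem uPoly_map (f : R →+* S) (c : Coord g → R) : (uPoly g c).map f = uPoly g (f ∘ c) := by
  simp [uPoly, Polynomial.map_sum]

theorem vPoly_map (f : R →+* S) (c : Coord g → R) : (vPoly g c).map f = vPoly g (f ∘ c) := by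
  simp [vPoly, Polynomial.map_sum]

theorem wPoly_map (f : R →+* S) (c : Coord g → R) : (wPoly g c).map f = wPoly g (f ∘ c) := by
  simp [wPoly, Polynomial.map_sum]

theorem momentMap_eq (c : Coord g → R) :
    momentMap g c = vPoly g c ^ 2 + uPoly g c * wPoly g c := by
  rw [momentMap, laxMatrix, Matrix.det_fin_two_of]
  ring

theorem momentMap_map (f : R →+* S) (c : Coord g → R) :
    (momentMap g c).map f = momentMap g (f ∘ c) := by
  simp only [momentMap_eq, Polynomial.map_add, Polynomial.map_mul, Polynomial.map_pow, uPoly_map,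
    vPoly_map, wPoly_map]

variable (A δ : Coord g → R)

theorem eval_comp_X : MvPolynomial.eval A ∘ MvPolynomial.X = A :=
  funext MvPolynomial.eval_X

theorem uPoly_map_eval : (uPoly g MvPolynomial.X).map (MvPolynomial.eval A) = uPoly g A := by
  rw [uPoly_map, eval_comp_X]

theorem vPoly_map_eval : (vPoly g MvPolynomial.X).map (MvPolynomial.eval A) = vPoly g A := by
  rw [vPoly_map, eval_comp_X]

theorem wPoly_map_eval : (wPoly g MvPolynomial.X).map (MvPolynomial.eval A) = wPoly g A := by
  rw [wPoly_map, eval_comp_X]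

theorem momentMap_map_eval :
    (momentMap g MvPolynomial.X).map (MvPolynomial.eval A) = momentMap g A := by
  rw [momentMap_map, eval_comp_X]

theorem uPoly_map_dualEval :
    (uPoly g MvPolynomial.X).map (dualEval A δ : MvPolynomial (Coord g) R →+* DualNumber R) =
      dualPoly (uPoly g A) (uTangent g δ) := by
  rw [uPoly_map, uPoly, uPoly, uTangent, ← X_pow_add_dualPoly, ← sum_C_inl_add_inr_mul_X_pow]
  simp [dualEval]

theorem vPoly_map_dualEval :
    (vPoly g MvPolynomial.X).map (dualEval A δ : MvPolynomial (Coord g) R →+* DualNumber R) =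
      dualPoly (vPoly g A) (vPoly g δ) := by
  rw [vPoly_map, vPoly, vPoly, vPoly, ← sum_C_inl_add_inr_mul_X_pow]
  simp [dualEval]

theorem wPoly_map_dualEval :
    (wPoly g MvPolynomial.X).map (dualEval A δ : MvPolynomial (Coord g) R →+* DualNumber R) =
      dualPoly (wPoly g A) (wTangent g δ) := by
  rw [wPoly_map, wPoly, wPoly, wTangent, ← X_pow_add_dualPoly, ← sum_C_inl_add_inr_mul_X_pow]
  simp [dualEval]

/-- The derivative of the moment map at `A` in the direction `δ`. -/
def momentMapDeriv : R[X] :=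
  2 * vPoly g A * vPoly g δ + uPoly g A * wTangent g δ + wPoly g A * uTangent g δ

theorem momentMap_map_dualEval :
    (momentMap g MvPolynomial.X).map (dualEval A δ : MvPolynomial (Coord g) R →+* DualNumber R) =
      dualPoly (momentMap g A) (momentMapDeriv g A δ) := by
  rw [momentMap_eq, Polynomial.map_add, Polynomial.map_mul, Polynomial.map_pow, uPoly_map_dualEval,
    vPoly_map_dualEval, wPoly_map_dualEval, pow_two, dualPoly_mul, dualPoly_mul, dualPoly_add,
    momentMap_eq, momentMapDeriv]
  congr 1 <;> ring

theorem degree_uTangent_lt : (uTangent g δ).degree < g :=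
  degree_sum_fin_lt _

theorem degree_vPoly_lt : (vPoly g A).degree < g :=
  degree_sum_fin_lt _

theorem degree_wTangent_lt : (wTangent g δ).degree < (g + 1 : ℕ) :=
  degree_sum_fin_lt _

theorem monic_uPoly : (uPoly g A).Monic :=
  monic_X_pow_add (degree_sum_fin_lt _)

theorem degree_uPoly [Nontrivial R] : (uPoly g A).degree = g :=
  (degree_add_eq_left_of_degree_lt (by rw [degree_X_pow]; exact degree_sum_fin_lt _)).trans
    (degree_X_pow g)

theorem monic_wPoly : (wPoly g A).Monic :=
  monic_X_pow_add (degree_sum_fin_lt _)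

theorem degree_wPoly [Nontrivial R] : (wPoly g A).degree = (g + 1 : ℕ) :=
  (degree_add_eq_left_of_degree_lt (by rw [degree_X_pow]; exact degree_sum_fin_lt _)).trans
    (degree_X_pow _)

/-- The part of `w(x)` not accounted for by its leading behaviour `x u(x)`. -/
def wReduced : R[X] := wPoly g A - X * uPoly g A

theorem degree_wReduced_le : degree (wReduced g A) ≤ g := by
  have hw : wReduced g A = wTangent g A - X * uTangent g A := by
    rw [wReduced, wPoly, uPoly, wTangent, uTangent]
    ring
  have hX : degree (X * uTangent g A) < (1 + g : ℕ) :=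
    degree_mul_lt_of_degree_le degree_X_le (degree_uTangent_lt g A)
  rw [add_comm] at hX
  rw [hw, ← mem_degreeLE, ← degreeLT_succ_eq_degreeLE]
  exact sub_mem (mem_degreeLT.2 (degree_wTangent_lt g A)) (mem_degreeLT.2 hX)

end Coordinates

end Mumford

/-! ### The Hamiltonian vector fields -/

namespace Mumford

section Flow

variable {g : ℕ} (A : PhaseSpace g)

theorem eval_uCoef (k : ℕ) : MvPolynomial.eval A (uCoef g k) = (uPoly g A).coeff k := by
  rw [uCoef, ← coeff_map, uPoly_map_eval]

theorem eval_vCoef (k : ℕ) : MvPolynomial.eval A (vCoef g k) = (vPoly g A).coeff k := by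
  rw [vCoef, ← coeff_map, vPoly_map_eval]

theorem eval_wCoef (k : ℕ) : MvPolynomial.eval A (wCoef g k) = (wPoly g A).coeff k := by
  rw [wCoef, ← coeff_map, wPoly_map_eval]

/-- The value at `A` of the Hamiltonian vector field `-{·, a}` of a coordinate function `a`. -/
def bracketAt (a : Coord g) : PhaseSpace g := fun b => MvPolynomial.eval A (coordBracket g a b)

theorem bracketAt_inl (i : Fin g) : bracketAt A (.inl i) =
    ofPoly g 0 (tail (i + 1) (uPoly g A)) (-(2 * tail (i + 1) (vPoly g A))) := by
  ext (j | j | j)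
  · simp [bracketAt, coordBracket, ofPoly]
  · simp [bracketAt, coordBracket, ofPoly, eval_uCoef, add_comm (i : ℕ), add_assoc]
  · simp [bracketAt, coordBracket, ofPoly, eval_vCoef, coeff_ofNat_mul, add_comm (i : ℕ),
      add_assoc]

theorem bracketAt_inr_inl (i : Fin g) : bracketAt A (.inr (.inl i)) =
    ofPoly g (-tail (i + 1) (uPoly g A)) 0
      (tail (i + 1) (wPoly g A) - C ((uPoly g A).coeff i)) := by
  ext (j | j | j)
  · simp [bracketAt, coordBracket, ofPoly, eval_uCoef, add_assoc]
  · simp [bracketAt, coordBracket, ofPoly]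
  · simp [bracketAt, coordBracket, ofPoly, eval_uCoef, eval_wCoef, coeff_C,
      apply_ite (MvPolynomial.eval A), add_comm (i : ℕ), add_assoc]

theorem bracketAt_inr_inr (i : Fin (g + 1)) : bracketAt A (.inr (.inr i)) =
    ofPoly g (2 * tail (i + 1) (vPoly g A))
      ((if i = 0 then uPoly g A else 0) - tail (i + 1) (wPoly g A))
      (2 * (C ((vPoly g A).coeff i) - if i = 0 then vPoly g A else 0)) := by
  ext (j | j | j)
  · simp [bracketAt, coordBracket, ofPoly, eval_vCoef, coeff_ofNat_mul, add_assoc]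
  · by_cases hi : i = 0 <;>
      simp [bracketAt, coordBracket, ofPoly, eval_uCoef, eval_wCoef, hi, add_assoc]
  · by_cases hi : i = 0 <;> by_cases hj : j = 0 <;>
      simp [bracketAt, coordBracket, ofPoly, eval_vCoef, coeff_ofNat_mul, coeff_C, hi, hj]

theorem vectorField_eq (k : ℕ) (a : Coord g) :
    vectorField g k A a = (momentMapDeriv g A (bracketAt A a)).coeff k := by
  have hderiv := snd_dualEval_coeff (momentMap_map_dualEval g A (bracketAt A a)) k
  rw [snd_dualEval] at hderiv
  simp only [vectorField, poissonBracket, hamiltonian, MvPolynomial.pderiv_X, Pi.single_apply]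
  rw [← hderiv, Finset.sum_eq_single a]
  · simp [bracketAt]
  · intro b _ hb
    simp [hb.symm]
  · simp

/-- The linear combination of the vector fields `D_k` in which `D_k` has the coefficient of
`X ^ (g - 1 - k)` in `c`. -/
def flow : ℂ[X] →ₗ[ℂ] PhaseSpace g where
  toFun c := ofPoly g (2 * bezoutian g (uPoly g A) (vPoly g A) c)
    (-bezoutian g (uPoly g A) (wReduced g A) c)
    (2 * (X * bezoutian g (vPoly g A) (uPoly g A) c - bezoutian g (wReduced g A) (vPoly g A) c))
  map_add' c c' := by
    ext (_ | _ | _) <;> simp [ofPoly, mul_add, coeff_ofNat_mul] <;> ring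
  map_smul' t c := by
    ext (_ | _ | _) <;> simp [ofPoly, coeff_ofNat_mul]
    ring

theorem flow_apply (c : ℂ[X]) :
    flow A c = ofPoly g (2 * bezoutian g (uPoly g A) (vPoly g A) c)
      (-bezoutian g (uPoly g A) (wReduced g A) c)
      (2 * (X * bezoutian g (vPoly g A) (uPoly g A) c -
        bezoutian g (wReduced g A) (vPoly g A) c)) :=
  rfl

theorem tail_uPoly_mem_degreeLT (i : ℕ) : tail (i + 1) (uPoly g A) ∈ degreeLT ℂ g :=
  tail_succ_mem_degreeLT (degree_uPoly g A).le i

theorem tail_vPoly_mem_degreeLT (i : ℕ) : tail (i + 1) (vPoly g A) ∈ degreeLT ℂ g :=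
  tail_succ_mem_degreeLT (degree_vPoly_lt g A).le i

theorem tail_wPoly_mem_degreeLT (i : ℕ) : tail (i + 1) (wPoly g A) ∈ degreeLT ℂ (g + 1) :=
  tail_succ_mem_degreeLT (degree_wPoly g A).le i

theorem two_mul_mem_degreeLT {p : ℂ[X]} {n : ℕ} (hp : p ∈ degreeLT ℂ n) :
    2 * p ∈ degreeLT ℂ n :=
  two_mul p ▸ add_mem hp hp

theorem C_mem_degreeLT_succ (a : ℂ) (n : ℕ) : C a ∈ degreeLT ℂ (n + 1) :=
  mem_degreeLT.2 (degree_C_le.trans_lt (by exact_mod_cast n.succ_pos))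

theorem tail_succ_wPoly (i : ℕ) :
    tail (i + 1) (wPoly g A) = tail (i + 1) (wReduced g A) + tail i (uPoly g A) := by
  rw [← tail_succ_X_mul i (uPoly g A), ← map_add, wReduced, sub_add_cancel]

theorem ite_uPoly_sub_tail_wPoly_mem_degreeLT (i : ℕ) :
    (if i = 0 then uPoly g A else 0) - tail (i + 1) (wPoly g A) ∈ degreeLT ℂ g := by
  have hw := tail_succ_mem_degreeLT (degree_wReduced_le g A) i
  rw [tail_succ_wPoly]
  rcases i with _ | i
  · rw [if_pos rfl, tail_zero, sub_add_cancel_right]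
    exact neg_mem hw
  · rw [if_neg i.succ_ne_zero, zero_sub]
    exact neg_mem (add_mem hw (tail_uPoly_mem_degreeLT A i))

theorem vectorField_inl (k : ℕ) (i : Fin g) : vectorField g k A (.inl i) =
    2 * (vPoly g A * tail (k + 1) (uPoly g A) - uPoly g A * tail (k + 1) (vPoly g A)).coeff i := by
  rw [vectorField_eq, bracketAt_inl, momentMapDeriv, uTangent_ofPoly (zero_mem _),
    vPoly_ofPoly (tail_uPoly_mem_degreeLT A i),
    wTangent_ofPoly (neg_mem (two_mul_mem_degreeLT
      (degreeLT_mono (Nat.le_succ g) (tail_vPoly_mem_degreeLT A i)))),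
    ← coeff_mul_tail_sub_comm, ← coeff_ofNat_mul]
  congr 1
  ring

theorem vectorField_inr_inl (k : ℕ) (i : Fin g) : vectorField g k A (.inr (.inl i)) =
    (uPoly g A * tail (k + 1) (wPoly g A) - wPoly g A * tail (k + 1) (uPoly g A)).coeff i -
      (uPoly g A).coeff k * (uPoly g A).coeff i := by
  rw [vectorField_eq, bracketAt_inr_inl, momentMapDeriv,
    uTangent_ofPoly (neg_mem (tail_uPoly_mem_degreeLT A i)), vPoly_ofPoly (zero_mem _),
    wTangent_ofPoly (sub_mem (tail_wPoly_mem_degreeLT A i) (C_mem_degreeLT_succ _ g)),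
    ← coeff_mul_tail_sub_comm, ← coeff_mul_C, ← coeff_sub]
  congr 1
  ring

theorem vectorField_inr_inr (k : ℕ) (i : Fin (g + 1)) : vectorField g k A (.inr (.inr i)) =
    2 * ((wPoly g A * tail (k + 1) (vPoly g A) - vPoly g A * tail (k + 1) (wPoly g A)).coeff i +
      (uPoly g A).coeff k * (vPoly g A).coeff i) := by
  have hv := ite_uPoly_sub_tail_wPoly_mem_degreeLT A i
  simp only [Fin.val_eq_zero_iff] at hv
  have hw : (if i = 0 then vPoly g A else 0) ∈ degreeLT ℂ (g + 1) := by
    split_ifs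
    · exact degreeLT_mono (Nat.le_succ g) (mem_degreeLT.2 (degree_vPoly_lt g A))
    · exact zero_mem _
  rw [vectorField_eq, bracketAt_inr_inr, momentMapDeriv,
    uTangent_ofPoly (two_mul_mem_degreeLT (tail_vPoly_mem_degreeLT A i)), vPoly_ofPoly hv,
    wTangent_ofPoly (two_mul_mem_degreeLT (sub_mem (C_mem_degreeLT_succ _ g) hw)),
    ← coeff_mul_tail_sub_comm, ← coeff_mul_C, ← coeff_add, ← coeff_ofNat_mul]
  congr 1
  split_ifs <;> ring

theorem flow_X_pow {m k : ℕ} (hmk : m + (k + 1) = g) : flow A (X ^ m) = vectorField g k A := by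
  have hbez (p q : ℂ[X]) :
      bezoutian g p q (X ^ m) = q * tail (k + 1) p - p * tail (k + 1) q :=
    hmk ▸ bezoutian_X_pow m (k + 1) p q
  have hw : tail (k + 1) (wReduced g A) + X * tail (k + 1) (uPoly g A) =
      tail (k + 1) (wPoly g A) - C ((uPoly g A).coeff k) := by
    rw [tail_succ_wPoly, ← X_mul_tail_succ k (uPoly g A)]
    ring
  ext (i | i | i) <;> simp only [flow_apply, ofPoly, hbez, Sum.elim_inl, Sum.elim_inr]
  · rw [vectorField_inl, ← coeff_ofNat_mul]
  · rw [vectorField_inr_inl, ← coeff_C_mul, ← coeff_sub]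
    congr 1
    rw [wReduced] at hw ⊢
    linear_combination uPoly g A * hw
  · rw [vectorField_inr_inr, ← coeff_C_mul, ← coeff_add, ← coeff_ofNat_mul]
    congr 1
    rw [wReduced] at hw ⊢
    linear_combination -2 * vPoly g A * hw

theorem map_flow_degreeLT :
    (degreeLT ℂ g).map (flow A) =
      Submodule.span ℂ (Set.range fun k : Fin g => vectorField g k A) := by
  rw [degreeLT_eq_span_X_pow, Submodule.map_span]
  congr 1
  ext x
  simp only [Finset.coe_image, Set.mem_image, Finset.coe_range, Set.mem_Iio, Set.mem_range,
    exists_exists_and_eq_and]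
  constructor
  · rintro ⟨m, hm, rfl⟩
    exact ⟨⟨g - (m + 1), by omega⟩, (flow_X_pow A (by dsimp only; omega)).symm⟩
  · rintro ⟨k, rfl⟩
    exact ⟨g - (k + 1), by omega, flow_X_pow A (by omega)⟩

theorem flow_eq_zero_iff (c : ℂ[X]) :
    flow A c = 0 ↔ bezoutian g (uPoly g A) (vPoly g A) c = 0 ∧
      bezoutian g (uPoly g A) (wReduced g A) c = 0 ∧
        bezoutian g (wReduced g A) (vPoly g A) c = 0 := by
  have hu := (degree_uPoly g A).le
  have hv := (degree_vPoly_lt g A).le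
  have hw := degree_wReduced_le g A
  have hvu := degree_mul_lt_of_degree_le (n := g) degree_X_le (degree_bezoutian_lt g hv hu c)
  rw [add_comm] at hvu
  rw [flow_apply, ofPoly_eq_zero_iff
    (two_mul_mem_degreeLT (mem_degreeLT.2 (degree_bezoutian_lt g hu hv c)))
    (neg_mem (mem_degreeLT.2 (degree_bezoutian_lt g hu hw c)))
    (two_mul_mem_degreeLT (sub_mem (mem_degreeLT.2 hvu)
      (degreeLT_mono g.le_succ (mem_degreeLT.2 (degree_bezoutian_lt g hw hv c)))))]
  rw [bezoutian_swap g (uPoly g A) (vPoly g A)]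
  simp +contextual

end Flow
end Mumford

/-! ### The rank of the vector fields -/

section UnimodularBezoutian

variable {R : Type*} [CommRing R]

theorem bezoutian_mul_left (k : ℕ) (r p q c : R[X]) :
    bezoutian k (r * p) (r * q) c = r * bezoutian k p q (r * c) := by
  simp only [bezoutian_apply, mul_sub, mul_assoc, mul_left_comm r]

theorem degree_lt_of_degree_monic_mul_lt {p q : R[X]} (hp : p.Monic) {m n : ℕ}
    (hn : p.natDegree = n) (hpq : (p * q).degree < (m + n : ℕ)) : q.degree < m := by
  rcases subsingleton_or_nontrivial R with _ | _
  · rw [Subsingleton.elim q 0, degree_zero]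
    exact WithBot.bot_lt_coe _
  rcases eq_or_ne q 0 with rfl | hq
  · rw [degree_zero]
    exact WithBot.bot_lt_coe _
  rw [← natDegree_lt_iff_degree_lt hq]
  rw [← natDegree_lt_iff_degree_lt (hp.mul_right_ne_zero hq), hp.natDegree_mul' hq, hn] at hpq
  omega

variable [Nontrivial R] {d e k : ℕ} {p q r s : R[X]}

theorem tail_mul_of_degree_lt (hk : d + e = k) (hs : (s %ₘ X ^ k).degree < d)
    (hp : p.degree ≤ e) : tail k (p * s) = p * tail k s := by
  have hlow : tail k (p * (s %ₘ X ^ k)) = 0 := by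
    rw [tail_eq_zero_iff, ← hk, add_comm d e]
    exact degree_mul_lt_of_degree_le hp (add_comm d e ▸ hk ▸ hs)
  conv_lhs => rw [← X_pow_mul_tail_add_modByMonic k s, mul_add, map_add, hlow, add_zero,
    mul_left_comm]
  exact tail_X_pow_mul k 0 _

theorem bezoutian_eq_zero_of_degree_lt (hk : d + e = k) (hs : (s %ₘ X ^ k).degree < d)
    (hp : p.degree ≤ e) (hq : q.degree ≤ e) : bezoutian k p q s = 0 := by
  rw [bezoutian_apply, tail_mul_of_degree_lt hk hs hp, tail_mul_of_degree_lt hk hs hq]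
  ring

theorem degree_lt_of_bezoutian_eq_zero (hk : d + e = k) (hp : p.Monic) (he : p.natDegree = e)
    {a b c : R[X]} (hbez : a * p + b * q + c * r = 1) (hq : bezoutian k p q s = 0)
    (hr : bezoutian k p r s = 0) : (s %ₘ X ^ k).degree < d := by
  rw [bezoutian_apply] at hq hr
  obtain ⟨f, hf⟩ : ∃ f, tail k (p * s) = p * f :=
    ⟨a * tail k (p * s) + b * tail k (q * s) + c * tail k (r * s), by
      linear_combination -tail k (p * s) * hbez + b * hq + c * hr⟩
  have hmul : p * (s - X ^ k * f) = p * s %ₘ X ^ k := by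
    linear_combination X ^ k * hf - X_pow_mul_tail_add_modByMonic k (p * s)
  have hlt : degree (s - X ^ k * f) < d := by
    refine degree_lt_of_degree_monic_mul_lt hp he ?_
    rw [hk, hmul]
    exact degree_modByMonic_X_pow_lt k _
  have hlt' : degree (s - X ^ k * f) < degree (X ^ k : R[X]) := by
    rw [degree_X_pow]
    exact hlt.trans_le (by exact_mod_cast hk ▸ Nat.le_add_right d e)
  rwa [(div_modByMonic_unique f _ (monic_X_pow _) ⟨sub_add_cancel _ _, hlt'⟩).2]

theorem exists_tail_mul_eq (hq : q.Monic) {t : R[X]} (ht : t.degree < e) :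
    ∃ c : R[X], (q * c).degree < (e + q.natDegree : ℕ) ∧ tail q.natDegree (q * c) = t := by
  have hr : (X ^ q.natDegree * t %ₘ q).degree < q.natDegree :=
    (degree_modByMonic_lt _ hq).trans_eq (degree_eq_natDegree hq.ne_zero)
  have hmul := eq_sub_of_add_eq' (modByMonic_add_div (X ^ q.natDegree * t) q)
  refine ⟨X ^ q.natDegree * t /ₘ q, ?_, ?_⟩ <;> rw [hmul]
  · refine (degree_sub_le _ _).trans_lt (max_lt ?_ (hr.trans_le ?_))
    · rw [add_comm]
      exact degree_mul_lt_of_degree_le (degree_X_pow_le _) ht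
    · exact_mod_cast Nat.le_add_left _ e
  · rw [map_sub, tail_eq_zero_iff.2 hr, sub_zero]
    exact tail_X_pow_mul q.natDegree 0 t

end UnimodularBezoutian

theorem finrank_map_eq_of_forall_mem {K V V₁ V₂ : Type*} [Ring K] [AddCommGroup V] [Module K V]
    [AddCommGroup V₁] [Module K V₁] [AddCommGroup V₂] [Module K V₂] {f : V →ₗ[K] V₁}
    {f' : V →ₗ[K] V₂} {W : Submodule K V} (h : ∀ x ∈ W, f x = 0 ↔ f' x = 0) :
    Module.finrank K (W.map f) = Module.finrank K (W.map f') := by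
  have hker : (f.domRestrict W).ker = (f'.domRestrict W).ker :=
    Submodule.ext fun x => h x x.2
  rw [← LinearMap.range_domRestrict, ← LinearMap.range_domRestrict]
  exact ((f.domRestrict W).quotKerEquivRange.symm ≪≫ₗ Submodule.quotEquivOfEq _ _ hker ≪≫ₗ
    (f'.domRestrict W).quotKerEquivRange).finrank_eq

theorem exists_monic_span_singleton_eq {K : Type*} [Field K] {I : Ideal K[X]} (hI : I ≠ ⊥) :
    ∃ q : K[X], q.Monic ∧ Ideal.span {q} = I := by
  classical
  obtain ⟨q, rfl⟩ := IsPrincipalIdealRing.principal I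
  have hq : q ≠ 0 := by
    rintro rfl
    simp at hI
  exact ⟨normalize q, monic_normalize hq,
    Ideal.span_singleton_eq_span_singleton.2 (normalize_associated q)⟩

namespace Mumford

variable {g : ℕ}

/-- A factorization of `(u, v, w)` as a monic greatest common divisor `Q` times a unimodular
triple, with Bézout coefficients for the latter. -/
structure GcdFactorization (A : PhaseSpace g) (Q : ℂ[X]) where
  monic : Q.Monic
  (u v w a b c : ℂ[X])
  uPoly_eq : uPoly g A = Q * u
  vPoly_eq : vPoly g A = Q * v
  wPoly_eq : wPoly g A = Q * w
  bezout : a * u + b * v + c * w = 1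

theorem exists_gcdFactorization (A : PhaseSpace g) : ∃ Q, Nonempty (GcdFactorization A Q) := by
  have hbot : Ideal.span {uPoly g A, vPoly g A, wPoly g A} ≠ ⊥ := fun h =>
    (monic_uPoly g A).ne_zero (Ideal.span_eq_bot.1 h _ (by simp))
  obtain ⟨Q, hQ, hspan⟩ := exists_monic_span_singleton_eq hbot
  have hdvd : ∀ p ∈ ({uPoly g A, vPoly g A, wPoly g A} : Set ℂ[X]), Q ∣ p := fun p hp =>
    Ideal.mem_span_singleton.1 (hspan ▸ Ideal.subset_span hp)
  obtain ⟨u, hu⟩ := hdvd (uPoly g A) (by simp)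
  obtain ⟨v, hv⟩ := hdvd (vPoly g A) (by simp)
  obtain ⟨w, hw⟩ := hdvd (wPoly g A) (by simp)
  have hmem := Ideal.mem_span_singleton_self Q
  rw [hspan] at hmem
  obtain ⟨a, y, hy, hay⟩ := Ideal.mem_span_insert.1 hmem
  obtain ⟨b, c, hbc⟩ := Ideal.mem_span_pair.1 hy
  refine ⟨Q, ⟨hQ, u, v, w, a, b, c, hu, hv, hw, mul_left_cancel₀ hQ.ne_zero ?_⟩⟩
  linear_combination a * -hu + b * -hv + c * -hw - hay + hbc

namespace GcdFactorization

variable {A : PhaseSpace g} {Q : ℂ[X]} (F : GcdFactorization A Q)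
include F

theorem monic_u : F.u.Monic := F.monic.of_mul_monic_left (F.uPoly_eq ▸ monic_uPoly g A)

theorem monic_w : F.w.Monic := F.monic.of_mul_monic_left (F.wPoly_eq ▸ monic_wPoly g A)

theorem natDegree_add : Q.natDegree + F.u.natDegree = g := by
  rw [← F.monic.natDegree_mul F.monic_u, ← F.uPoly_eq,
    natDegree_eq_of_degree_eq_some (degree_uPoly g A)]

theorem natDegree_w : F.w.natDegree = F.u.natDegree + 1 := by
  have h : Q.natDegree + F.w.natDegree = g + 1 := by
    rw [← F.monic.natDegree_mul F.monic_w, ← F.wPoly_eq,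
      natDegree_eq_of_degree_eq_some (degree_wPoly g A)]
  have := F.natDegree_add
  omega

theorem degree_v_lt : F.v.degree < F.u.natDegree := by
  refine degree_lt_of_degree_monic_mul_lt F.monic rfl ?_
  rw [← F.vPoly_eq, add_comm, F.natDegree_add]
  exact degree_vPoly_lt g A

theorem wReduced_eq : wReduced g A = Q * (F.w - X * F.u) := by
  rw [wReduced, F.wPoly_eq, F.uPoly_eq]
  ring

theorem degree_w_sub_le : degree (F.w - X * F.u) ≤ F.u.natDegree := by
  rw [← mem_degreeLE, ← degreeLT_succ_eq_degreeLE, mem_degreeLT]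
  refine degree_lt_of_degree_monic_mul_lt F.monic rfl ?_
  rw [← F.wReduced_eq, add_right_comm, add_comm F.u.natDegree, F.natDegree_add, ← mem_degreeLT,
    degreeLT_succ_eq_degreeLE, mem_degreeLE]
  exact degree_wReduced_le g A

theorem flow_eq_zero_iff_degree_lt (c : ℂ[X]) :
    flow A c = 0 ↔ (Q * c %ₘ X ^ g).degree < Q.natDegree := by
  have hQ := F.monic.ne_zero
  simp only [flow_eq_zero_iff, F.wReduced_eq, F.uPoly_eq, F.vPoly_eq, bezoutian_mul_left,
    mul_eq_zero, hQ, false_or]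
  refine ⟨fun ⟨huv, huw, _⟩ => ?_, fun h => ?_⟩
  · refine degree_lt_of_bezoutian_eq_zero F.natDegree_add F.monic_u rfl (a := F.a + F.c * X)
      (b := F.b) (c := F.c) ?_ huv huw
    linear_combination F.bezout
  · have hzero {p q : ℂ[X]} := bezoutian_eq_zero_of_degree_lt (p := p) (q := q) F.natDegree_add h
    exact ⟨hzero degree_le_natDegree F.degree_v_lt.le, hzero degree_le_natDegree F.degree_w_sub_le,
      hzero F.degree_w_sub_le F.degree_v_lt.le⟩

theorem finrank_span_vectorField :
    Module.finrank ℂ (Submodule.span ℂ (Set.range fun k : Fin g => vectorField g k A)) =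
      F.u.natDegree := by
  let ψ : ℂ[X] →ₗ[ℂ] ℂ[X] :=
    tail Q.natDegree ∘ₗ modByMonicHom (X ^ g) ∘ₗ LinearMap.mulLeft ℂ Q
  have hψ (c : ℂ[X]) : ψ c = tail Q.natDegree (Q * c %ₘ X ^ g) := rfl
  have hrange : (degreeLT ℂ g).map ψ = degreeLT ℂ F.u.natDegree := by
    refine le_antisymm ?_ fun t ht => ?_
    · rintro _ ⟨c, -, rfl⟩
      refine tail_mem_degreeLT ?_
      rw [add_comm, F.natDegree_add]
      exact degree_modByMonic_X_pow_lt g (Q * c)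
    · obtain ⟨c, hc, rfl⟩ := exists_tail_mul_eq F.monic (mem_degreeLT.1 ht)
      rw [add_comm, F.natDegree_add] at hc
      refine ⟨c, mem_degreeLT.2 (degree_lt_of_degree_monic_mul_lt F.monic rfl
        (hc.trans_le (by exact_mod_cast Nat.le_add_right g _))), ?_⟩
      rw [hψ, (modByMonic_eq_self_iff (monic_X_pow g)).2 (hc.trans_eq (degree_X_pow g).symm)]
  rw [← map_flow_degreeLT, finrank_map_eq_of_forall_mem (f' := ψ) fun c _ => by
    rw [F.flow_eq_zero_iff_degree_lt, hψ, tail_eq_zero_iff], hrange,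
    (degreeLTEquiv ℂ F.u.natDegree).finrank_eq, Module.finrank_fin_fun]

theorem mem_stratum_iff (i : ℕ) : A ∈ stratum g i ↔ Q.natDegree + i = g := by
  rw [stratum, Set.mem_ofPred_eq, F.finrank_span_vectorField]
  have := F.natDegree_add
  omega

end GcdFactorization

end Mumford

/-! ### The strata of a fibre -/

section Coefficients

variable {σ R : Type*} [CommRing R]

theorem map_C_map_eval (p : σ → R) (q : R[X]) :
    (q.map MvPolynomial.C).map (MvPolynomial.eval p) = q := by
  ext n
  simp

theorem eval_coeff_modByMonic (p : σ → R) (P : (MvPolynomial σ R)[X]) {q : R[X]} (hq : q.Monic)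
    (n : ℕ) : MvPolynomial.eval p ((P %ₘ q.map MvPolynomial.C).coeff n) =
      (P.map (MvPolynomial.eval p) %ₘ q).coeff n := by
  rw [← coeff_map, map_modByMonic _ (hq.map _), map_C_map_eval]

theorem eval_coeff_divByMonic (p : σ → R) (P : (MvPolynomial σ R)[X]) {q : R[X]} (hq : q.Monic)
    (n : ℕ) : MvPolynomial.eval p ((P /ₘ q.map MvPolynomial.C).coeff n) =
      (P.map (MvPolynomial.eval p) /ₘ q).coeff n := by
  rw [← coeff_map, map_divByMonic _ (hq.map _), map_C_map_eval]

theorem forall_fin_coeff_eq_zero_iff {p : R[X]} {n : ℕ} (hp : p.degree < n) :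
    (∀ j : Fin n, p.coeff j = 0) ↔ p = 0 := by
  refine ⟨fun h => ?_, fun h j => by rw [h, coeff_zero]⟩
  rw [← sum_C_coeff_mul_X_pow hp]
  simp [h]

theorem forall_fin_coeff_modByMonic_eq_zero_iff [Nontrivial R] (p : R[X]) {q : R[X]}
    (hq : q.Monic) : (∀ j : Fin q.natDegree, (p %ₘ q).coeff j = 0) ↔ q ∣ p := by
  rw [forall_fin_coeff_eq_zero_iff, modByMonic_eq_zero_iff_dvd hq]
  exact (degree_modByMonic_lt p hq).trans_eq (degree_eq_natDegree hq.ne_zero)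

theorem degree_divByMonic_lt_of_degree_lt [Nontrivial R] {p q : R[X]} (hq : q.Monic) {k : ℕ}
    (hp : p.degree < (q.natDegree + k : ℕ)) : (p /ₘ q).degree < k := by
  refine degree_lt_of_degree_monic_mul_lt hq rfl ?_
  rw [eq_sub_of_add_eq' (modByMonic_add_div p q), add_comm]
  refine (degree_sub_le _ _).trans_lt (max_lt hp ((degree_modByMonic_lt p hq).trans_le ?_))
  rw [degree_eq_natDegree hq.ne_zero]
  exact_mod_cast Nat.le_add_right _ k

theorem divByMonic_eq_zero_iff_of_dvd {p q : R[X]} (hq : q.Monic) (hqp : q ∣ p) :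
    p /ₘ q = 0 ↔ p = 0 := by
  obtain ⟨r, rfl⟩ := hqp
  rw [mul_divByMonic_cancel_left r hq, hq.mul_right_eq_zero_iff]

end Coefficients

namespace Mumford

open ClassicalVariety

variable {g : ℕ}

/-- The polynomial `Q` divides the entries of the Lax matrix of `A`. -/
def DividesLax (Q : ℂ[X]) (A : PhaseSpace g) : Prop :=
  Q ∣ uPoly g A ∧ Q ∣ vPoly g A ∧ Q ∣ wPoly g A

theorem DividesLax.sq_dvd {Q : ℂ[X]} {A : PhaseSpace g} (hQ : DividesLax Q A) :
    Q ^ 2 ∣ momentMap g A := by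
  obtain ⟨⟨u, hu⟩, ⟨v, hv⟩, w, hw⟩ := hQ
  exact ⟨v ^ 2 + u * w, by rw [momentMap_eq, hu, hv, hw]; ring⟩

theorem mem_fiber_iff {h : ℂ[X]} {A : PhaseSpace g} : A ∈ fiber g h ↔ momentMap g A = h :=
  Iff.rfl

theorem DividesLax.dvd {Q h : ℂ[X]} {A : PhaseSpace g} (hQ : DividesLax Q A)
    (hA : A ∈ fiber g h) : Q ∣ h :=
  (dvd_pow_self Q two_ne_zero).trans (mem_fiber_iff.1 hA ▸ hQ.sq_dvd)

namespace GcdFactorization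

variable {A : PhaseSpace g} {Q : ℂ[X]} (F : GcdFactorization A Q)
include F

theorem dividesLax : DividesLax Q A :=
  ⟨⟨_, F.uPoly_eq⟩, ⟨_, F.vPoly_eq⟩, ⟨_, F.wPoly_eq⟩⟩

theorem dividesLax_iff_dvd {P : ℂ[X]} : DividesLax P A ↔ P ∣ Q := by
  refine ⟨fun ⟨hu, hv, hw⟩ => ?_, fun h => ⟨h.trans F.dividesLax.1, h.trans F.dividesLax.2.1,
    h.trans F.dividesLax.2.2⟩⟩
  have hQ : Q = F.a * uPoly g A + F.b * vPoly g A + F.c * wPoly g A := by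
    rw [F.uPoly_eq, F.vPoly_eq, F.wPoly_eq]
    linear_combination -Q * F.bezout
  rw [hQ]
  exact dvd_add (dvd_add (hu.mul_left _) (hv.mul_left _)) (hw.mul_left _)

end GcdFactorization

theorem isClosed_dividesLax {Q : ℂ[X]} (hQ : Q.Monic) :
    IsClosed[zariskiTopology _] {A : PhaseSpace g | DividesLax Q A} := by
  convert isClosed_setOf_eval_eq_zero (σ := Coord g) (ι := Fin 3 × ℕ) (fun j =>
    (![uPoly g MvPolynomial.X, vPoly g MvPolynomial.X, wPoly g MvPolynomial.X] j.1 %ₘ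
      Q.map MvPolynomial.C).coeff j.2) using 1
  ext A
  simp only [Set.mem_ofPred_eq, DividesLax, eval_coeff_modByMonic A _ hQ, Prod.forall,
    Fin.forall_fin_succ, ← modByMonic_eq_zero_iff_dvd hQ, Polynomial.ext_iff]
  simp [uPoly_map_eval, vPoly_map_eval, wPoly_map_eval]

theorem isClosed_fiber (h : ℂ[X]) : IsClosed[zariskiTopology _] (fiber g h) := by
  convert isClosed_setOf_eval_eq_zero (σ := Coord g) (fun j : ℕ =>
    (momentMap g MvPolynomial.X - h.map MvPolynomial.C).coeff j) using 1
  ext A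
  have hcoeff (n : ℕ) :
      MvPolynomial.eval A ((momentMap g MvPolynomial.X - h.map MvPolynomial.C).coeff n) =
        (momentMap g A).coeff n - h.coeff n := by
    rw [← coeff_map, Polynomial.map_sub, momentMap_map_eval, map_C_map_eval, coeff_sub]
  simp only [hcoeff, sub_eq_zero, mem_fiber_iff, Set.mem_ofPred_eq, Polynomial.ext_iff]

theorem isClosed_setOf_exists_dividesLax {h : ℂ[X]} (hh : h ≠ 0) (p : ℂ[X] → Prop) :
    IsClosed[zariskiTopology _]
      {A : PhaseSpace g | ∃ P, (P.Monic ∧ P ∣ h) ∧ p P ∧ DividesLax P A} := by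
  let _ := zariskiTopology (Coord g)
  have hfin : {P : ℂ[X] | P.Monic ∧ P ∣ h}.Finite := @Set.toFinite _ _ <|
    @Finite.of_fintype _ (fintypeSubtypeMonicDvd h hh)
  convert (hfin.subset (t := {P | (P.Monic ∧ P ∣ h) ∧ p P}) fun P hP => hP.1).isClosed_biUnion
    fun P hP => isClosed_dividesLax (g := g) hP.1.1 using 1
  ext A
  simp [and_assoc]

theorem isQuasiAffine_fiberStratum {h : ℂ[X]} (hh : h ≠ 0) (i : ℕ) :
    IsQuasiAffine (fiberStratum g i h) := by
  let _ := zariskiTopology (Coord g)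
  let Z (n : ℕ) : Set (PhaseSpace g) :=
    {A | ∃ P, (P.Monic ∧ P ∣ h) ∧ n ≤ P.natDegree + i ∧ DividesLax P A}
  have hZ (n : ℕ) : IsClosed (Z n) := isClosed_setOf_exists_dividesLax hh _
  have hmem {A : PhaseSpace g} {Q : ℂ[X]} (F : GcdFactorization A Q) (hA : A ∈ fiber g h) (n : ℕ) :
      A ∈ Z n ↔ n ≤ Q.natDegree + i := by
    refine ⟨fun ⟨P, _, hn, hP⟩ => hn.trans ?_, fun hn =>
      ⟨Q, ⟨F.monic, F.dividesLax.dvd hA⟩, hn, F.dividesLax⟩⟩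
    exact Nat.add_le_add_right (natDegree_le_of_dvd (F.dividesLax_iff_dvd.1 hP) F.monic.ne_zero) i
  have hS : fiberStratum g i h = (fiber g h ∩ Z g) ∩ (Z (g + 1))ᶜ := by
    ext A
    obtain ⟨Q, ⟨F⟩⟩ := exists_gcdFactorization A
    rw [fiberStratum, Set.inter_assoc, Set.mem_inter_iff, Set.mem_inter_iff A (fiber g h)]
    refine and_congr_right fun hA => ?_
    rw [F.mem_stratum_iff, Set.mem_inter_iff, Set.mem_compl_iff, hmem F hA, hmem F hA]
    omega
  rw [hS]
  exact ((isClosed_fiber h).inter (hZ g)).isLocallyClosed.inter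
    (hZ (g + 1)).isOpen_compl.isLocallyClosed

theorem GcdFactorization.exists_isOpen_forall_mem_fiberStratum_iff {h Q : ℂ[X]} (hh : h ≠ 0)
    {A : PhaseSpace g} (F : GcdFactorization A Q) {i : ℕ} (hi : Q.natDegree + i = g) :
    ∃ U : Set (PhaseSpace g), IsOpen[zariskiTopology _] U ∧ A ∈ U ∧
      ∀ B ∈ U, B ∈ fiberStratum g i h ↔ DividesLax Q B ∧ B ∈ fiber g h := by
  let _ := zariskiTopology (Coord g)
  refine ⟨{B | ∃ P, (P.Monic ∧ P ∣ h) ∧ (P ≠ Q ∧ Q.natDegree ≤ P.natDegree) ∧ DividesLax P B}ᶜ,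
    (isClosed_setOf_exists_dividesLax hh _).isOpen_compl, ?_, fun B hB => ?_⟩
  · rintro ⟨P, ⟨hP, -⟩, ⟨hPQ, hle⟩, hPA⟩
    exact hPQ (eq_of_monic_of_dvd_of_natDegree_le hP F.monic (F.dividesLax_iff_dvd.1 hPA) hle).symm
  · obtain ⟨P, ⟨FB⟩⟩ := exists_gcdFactorization B
    have heq (hBh : B ∈ fiber g h) (hle : Q.natDegree ≤ P.natDegree) : P = Q := by
      by_contra hPQ
      exact hB ⟨P, ⟨FB.monic, FB.dividesLax.dvd hBh⟩, ⟨hPQ, hle⟩, FB.dividesLax⟩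
    rw [fiberStratum, Set.mem_inter_iff, FB.mem_stratum_iff, FB.dividesLax_iff_dvd, and_comm]
    refine and_congr_left fun hBh => ⟨fun hPi => ?_, fun hQP => ?_⟩
    · rw [heq hBh (by omega)]
    · rwa [heq hBh (natDegree_le_of_dvd hQP FB.monic.ne_zero)]

theorem degree_momentMap_sub_lt {h : ℂ[X]} (hmonic : h.Monic) (hdeg : h.natDegree = 2 * g + 1)
    (A : PhaseSpace g) : (momentMap g A - h).degree < (2 * g + 1 : ℕ) := by
  have huw : (uPoly g A * wPoly g A).degree = (2 * g + 1 : ℕ) := by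
    rw [degree_mul, degree_uPoly, degree_wPoly]
    norm_cast
    ring
  have hh : h.degree = (2 * g + 1 : ℕ) := by rw [degree_eq_natDegree hmonic.ne_zero, hdeg]
  have hv : (vPoly g A ^ 2).degree < (2 * g + 1 : ℕ) := by
    rw [sq]
    refine (degree_mul_lt_of_degree_le (degree_vPoly_lt g A).le (degree_vPoly_lt g A)).trans_le ?_
    exact_mod_cast (by omega : g + g ≤ 2 * g + 1)
  have hlead := (monic_uPoly g A).mul (monic_wPoly g A)
  rw [momentMap_eq, add_sub_assoc]
  refine (degree_add_le _ _).trans_lt (max_lt hv ?_)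
  rw [← huw]
  exact degree_sub_lt_left (huw.trans hh.symm) hlead.ne_zero
    (hlead.leadingCoeff.trans hmonic.leadingCoeff.symm)

/-- Equations for the stratum of the fibre over `h` near a point where `Q` is the greatest common
divisor of `u`, `v` and `w`: the coefficients of the remainders of `u`, `v` and `w` modulo `Q`, and
of the quotient of `H - h` by `Q ^ 2`. -/
def stratumEquation (h Q : ℂ[X]) (i : ℕ) :
    Fin Q.natDegree ⊕ Fin Q.natDegree ⊕ Fin Q.natDegree ⊕ Fin (2 * i + 1) → Functions g
  | .inl j => (uPoly g MvPolynomial.X %ₘ Q.map MvPolynomial.C).coeff j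
  | .inr (.inl j) => (vPoly g MvPolynomial.X %ₘ Q.map MvPolynomial.C).coeff j
  | .inr (.inr (.inl j)) => (wPoly g MvPolynomial.X %ₘ Q.map MvPolynomial.C).coeff j
  | .inr (.inr (.inr j)) =>
      ((momentMap g MvPolynomial.X - h.map MvPolynomial.C) /ₘ (Q ^ 2).map MvPolynomial.C).coeff j

theorem forall_eval_stratumEquation_eq_zero_iff {h Q : ℂ[X]} {i : ℕ} (hmonic : h.Monic)
    (hdeg : h.natDegree = 2 * g + 1) (hQ : Q.Monic) (hQh : Q ^ 2 ∣ h)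
    (hi : Q.natDegree + i = g) (A : PhaseSpace g) :
    (∀ j, MvPolynomial.eval A (stratumEquation h Q i j) = 0) ↔ DividesLax Q A ∧ A ∈ fiber g h := by
  have hquot : ((momentMap g A - h) /ₘ Q ^ 2).degree < (2 * i + 1 : ℕ) := by
    refine degree_divByMonic_lt_of_degree_lt (hQ.pow 2) ?_
    rw [hQ.natDegree_pow, show 2 * Q.natDegree + (2 * i + 1) = 2 * g + 1 by omega]
    exact degree_momentMap_sub_lt hmonic hdeg A
  simp only [Sum.forall, stratumEquation, eval_coeff_modByMonic A _ hQ,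
    eval_coeff_divByMonic A _ (hQ.pow 2), Polynomial.map_sub, uPoly_map_eval, vPoly_map_eval,
    wPoly_map_eval, momentMap_map_eval, map_C_map_eval,
    forall_fin_coeff_modByMonic_eq_zero_iff _ hQ, forall_fin_coeff_eq_zero_iff hquot]
  rw [← and_assoc, ← and_assoc, and_assoc (a := Q ∣ uPoly g A)]
  refine and_congr_right fun hQA : DividesLax Q A => ?_
  rw [divByMonic_eq_zero_iff_of_dvd (hQ.pow 2) (dvd_sub hQA.sq_dvd hQh), sub_eq_zero,
    mem_fiber_iff]

end Mumford

/-! ### Tangent vectors with prescribed derivatives -/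

section DualDivision

variable {σ R : Type*} [CommRing R] {p δ : σ → R} {P : (MvPolynomial σ R)[X]} {a b q : R[X]}

theorem map_dualEval_map_C (p δ : σ → R) (q : R[X]) :
    (q.map MvPolynomial.C).map (dualEval p δ : MvPolynomial σ R →+* DualNumber R) =
      q.map (TrivSqZeroExt.inlHom R R) := by
  rw [Polynomial.map_map]
  congr 1
  ext c <;> simp [dualEval, TrivSqZeroExt.algebraMap_eq_inl]

theorem map_dualEval_divByMonic (hq : q.Monic)
    (h : P.map (dualEval p δ : MvPolynomial σ R →+* DualNumber R) = dualPoly a b) :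
    (P /ₘ q.map MvPolynomial.C).map (dualEval p δ : MvPolynomial σ R →+* DualNumber R) =
      dualPoly (a /ₘ q) (b /ₘ q) := by
  rw [map_divByMonic _ (hq.map _), h, map_dualEval_map_C, (dualPoly_div_modByMonic a b hq).1]

theorem map_dualEval_modByMonic (hq : q.Monic)
    (h : P.map (dualEval p δ : MvPolynomial σ R →+* DualNumber R) = dualPoly a b) :
    (P %ₘ q.map MvPolynomial.C).map (dualEval p δ : MvPolynomial σ R →+* DualNumber R) =
      dualPoly (a %ₘ q) (b %ₘ q) := by
  rw [map_modByMonic _ (hq.map _), h, map_dualEval_map_C, (dualPoly_div_modByMonic a b hq).2]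

end DualDivision

section UnimodularEquation

variable {R : Type*} [CommRing R]

theorem exists_mul_add_mul_add_mul_eq [Nontrivial R] {u v w a b c P : R[X]} {e : ℕ} (hu : u.Monic)
    (he : u.natDegree = e) (hv : v.degree ≤ e) (hw : w.degree ≤ (e + 1 : ℕ))
    (hbez : a * u + b * v + c * w = 1) (hP : P.degree < (e + 1 + e : ℕ)) :
    ∃ x y z : R[X], x.degree < (e + 1 : ℕ) ∧ y.degree < e ∧ z.degree < e ∧
      u * x + v * y + w * z = P := by
  have hmod (p : R[X]) : (p %ₘ u).degree < e :=
    (degree_modByMonic_lt p hu).trans_eq ((degree_eq_natDegree hu.ne_zero).trans (by rw [he]))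
  have heq : u * (a * P + v * (b * P /ₘ u) + w * (c * P /ₘ u)) + v * (b * P %ₘ u) +
      w * (c * P %ₘ u) = P := by
    linear_combination v * modByMonic_add_div (b * P) u + w * modByMonic_add_div (c * P) u +
      P * hbez
  refine ⟨_, _, _, degree_lt_of_degree_monic_mul_lt hu he ?_, hmod _, hmod _, heq⟩
  rw [add_assoc, ← eq_sub_iff_add_eq] at heq
  rw [heq, ← mem_degreeLT]
  refine sub_mem (mem_degreeLT.2 hP) (add_mem (mem_degreeLT.2 ?_) (mem_degreeLT.2 ?_))
  · refine (degree_mul_lt_of_degree_le hv (hmod _)).trans_le ?_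
    exact_mod_cast (by omega : e + e ≤ e + 1 + e)
  · exact degree_mul_lt_of_degree_le hw (hmod _)

theorem exists_degree_lt_forall_coeff_eq {n : ℕ} (t : Fin n → R) :
    ∃ p : R[X], p.degree < n ∧ ∀ j : Fin n, p.coeff j = t j :=
  ⟨∑ j, C (t j) * X ^ (j : ℕ), degree_sum_fin_lt t, fun j => by simp [Fin.val_inj]⟩

theorem add_mul_mem_degreeLT {r q x : R[X]} {k m n : ℕ} (hr : r.degree < k) (hq : q.degree ≤ k)
    (hx : x.degree < m) (hn : k + m = n) : r + q * x ∈ degreeLT R n := by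
  subst hn
  refine add_mem (mem_degreeLT.2 (hr.trans_le ?_))
    (mem_degreeLT.2 (degree_mul_lt_of_degree_le hq hx))
  exact_mod_cast Nat.le_add_right k m

theorem add_mul_modByMonic_eq_left {r q : R[X]} (hq : q.Monic) (hr : r.degree < q.natDegree)
    (x : R[X]) : (r + q * x) %ₘ q = r := by
  nontriviality R
  exact (div_modByMonic_unique x r hq ⟨rfl, hr.trans_eq (degree_eq_natDegree hq.ne_zero).symm⟩).2

theorem add_mul_divByMonic {q : R[X]} (hq : q.Monic) (p x : R[X]) :
    (p + q * x) /ₘ q = p /ₘ q + x := by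
  nontriviality R
  refine (div_modByMonic_unique _ (p %ₘ q) hq ⟨?_, degree_modByMonic_lt p hq⟩).1
  linear_combination modByMonic_add_div p q

end UnimodularEquation

namespace Mumford

open ClassicalVariety

theorem degree_momentMapDeriv_lt {R : Type*} [CommRing R] [Nontrivial R] (g : ℕ)
    (A δ : Coord g → R) : (momentMapDeriv g A δ).degree < (2 * g + 1 : ℕ) := by
  have huw : (uPoly g A * wTangent g δ).degree < (g + (g + 1) : ℕ) :=
    degree_mul_lt_of_degree_le (degree_uPoly g A).le (degree_wTangent_lt g δ)
  have hwu : (wPoly g A * uTangent g δ).degree < (g + 1 + g : ℕ) :=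
    degree_mul_lt_of_degree_le (degree_wPoly g A).le (degree_uTangent_lt g δ)
  have hvv : (vPoly g A * vPoly g δ).degree < (g + g : ℕ) :=
    degree_mul_lt_of_degree_le (degree_vPoly_lt g A).le (degree_vPoly_lt g δ)
  rw [momentMapDeriv, mul_assoc, two_mul, ← mem_degreeLT]
  have hle {p : R[X]} {n : ℕ} (hp : p.degree < n) (hn : n ≤ 2 * g + 1) :
      p ∈ degreeLT R (2 * g + 1) :=
    mem_degreeLT.2 (hp.trans_le (by exact_mod_cast hn))
  exact add_mem (add_mem (add_mem (hle hvv (by omega)) (hle hvv (by omega)))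
    (hle huw (by omega))) (hle hwu (by omega))

variable {g : ℕ}

theorem momentMapDeriv_ofPoly {R : Type*} [CommRing R] (A : Coord g → R) {U V W : R[X]}
    (hU : U ∈ degreeLT R g) (hV : V ∈ degreeLT R g) (hW : W ∈ degreeLT R (g + 1)) :
    momentMapDeriv g A (ofPoly g U V W) = 2 * vPoly g A * V + uPoly g A * W + wPoly g A * U := by
  rw [momentMapDeriv, uTangent_ofPoly hU, vPoly_ofPoly hV, wTangent_ofPoly hW]

namespace GcdFactorization

variable {A : PhaseSpace g} {Q : ℂ[X]} (F : GcdFactorization A Q)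
include F

theorem exists_mul_add_two_mul_add_mul_eq {P : ℂ[X]}
    (hP : P.degree < (2 * F.u.natDegree + 1 : ℕ)) :
    ∃ α β γ : ℂ[X], α.degree < F.u.natDegree ∧ β.degree < F.u.natDegree ∧
      γ.degree < (F.u.natDegree + 1 : ℕ) ∧ 2 * F.v * β + F.u * γ + F.w * α = P := by
  have htwo : C (2⁻¹ : ℂ) * 2 = 1 := by
    rw [← C_ofNat, ← C_mul, inv_mul_cancel₀ two_ne_zero, C_1]
  have hv := mem_degreeLT.1 (two_mul_mem_degreeLT (mem_degreeLT.2 F.degree_v_lt))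
  have hbez : F.a * F.u + C 2⁻¹ * F.b * (2 * F.v) + F.c * F.w = 1 := by
    linear_combination F.bezout + F.b * F.v * htwo
  have hw : F.w.degree ≤ (F.u.natDegree + 1 : ℕ) := F.natDegree_w ▸ degree_le_natDegree
  rw [two_mul, add_right_comm] at hP
  obtain ⟨γ, β, α, hγ, hβ, hα, h⟩ := exists_mul_add_mul_add_mul_eq F.monic_u rfl hv.le hw hbez hP
  exact ⟨α, β, γ, hα, hβ, hγ, by rw [← h]; ring⟩

theorem exists_tangent {r s t τ : ℂ[X]} (hr : r.degree < Q.natDegree) (hs : s.degree < Q.natDegree)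
    (ht : t.degree < Q.natDegree) (hτ : τ.degree < (2 * F.u.natDegree + 1 : ℕ)) :
    ∃ δ : PhaseSpace g, uTangent g δ %ₘ Q = r ∧ vPoly g δ %ₘ Q = s ∧ wTangent g δ %ₘ Q = t ∧
      momentMapDeriv g A δ /ₘ Q ^ 2 = τ := by
  have hg := F.natDegree_add
  let N := momentMapDeriv g A (ofPoly g r s t)
  have hτN : (τ - N /ₘ Q ^ 2).degree < (2 * F.u.natDegree + 1 : ℕ) := by
    refine (degree_sub_le _ _).trans_lt (max_lt hτ ?_)
    refine degree_divByMonic_lt_of_degree_lt (F.monic.pow 2) ?_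
    rw [F.monic.natDegree_pow, show 2 * Q.natDegree + (2 * F.u.natDegree + 1) = 2 * g + 1 by omega]
    exact degree_momentMapDeriv_lt g A _
  obtain ⟨α, β, γ, hα, hβ, hγ, heq⟩ := F.exists_mul_add_two_mul_add_mul_eq hτN
  have hmem {ρ : ℂ[X]} (hρ : ρ.degree < Q.natDegree) {n : ℕ} (hn : Q.natDegree ≤ n) :
      ρ ∈ degreeLT ℂ n := degreeLT_mono hn (mem_degreeLT.2 hρ)
  have hU := add_mul_mem_degreeLT hr degree_le_natDegree hα hg
  have hV := add_mul_mem_degreeLT hs degree_le_natDegree hβ hg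
  have hW := add_mul_mem_degreeLT ht degree_le_natDegree hγ
    (by omega : Q.natDegree + (F.u.natDegree + 1) = g + 1)
  have hderiv : momentMapDeriv g A (ofPoly g (r + Q * α) (s + Q * β) (t + Q * γ)) =
      N + Q ^ 2 * (τ - N /ₘ Q ^ 2) := by
    have hN' : N = 2 * vPoly g A * s + uPoly g A * t + wPoly g A * r :=
      momentMapDeriv_ofPoly A (hmem hr (by omega)) (hmem hs (by omega)) (hmem ht (by omega))
    rw [momentMapDeriv_ofPoly A hU hV hW, ← heq, hN', F.uPoly_eq, F.vPoly_eq, F.wPoly_eq]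
    ring
  refine ⟨ofPoly g (r + Q * α) (s + Q * β) (t + Q * γ), ?_⟩
  rw [hderiv, add_mul_divByMonic (F.monic.pow 2), add_sub_cancel, uTangent_ofPoly hU,
    vPoly_ofPoly hV, wTangent_ofPoly hW]
  exact ⟨add_mul_modByMonic_eq_left F.monic hr α, add_mul_modByMonic_eq_left F.monic hs β,
    add_mul_modByMonic_eq_left F.monic ht γ, rfl⟩

theorem surjective_dualEval_stratumEquation (h : ℂ[X]) :
    Function.Surjective fun (δ : PhaseSpace g) j =>
      (dualEval A δ (stratumEquation h Q F.u.natDegree j)).snd := by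
  intro t
  obtain ⟨r, hr, hrt⟩ := exists_degree_lt_forall_coeff_eq fun j => t (.inl j)
  obtain ⟨s, hs, hst⟩ := exists_degree_lt_forall_coeff_eq fun j => t (.inr (.inl j))
  obtain ⟨q, hq, hqt⟩ := exists_degree_lt_forall_coeff_eq fun j => t (.inr (.inr (.inl j)))
  obtain ⟨τ, hτ, hτt⟩ := exists_degree_lt_forall_coeff_eq fun j => t (.inr (.inr (.inr j)))
  obtain ⟨δ, hu, hv, hw, hH⟩ := F.exists_tangent hr hs hq hτ
  have hmap : (momentMap g MvPolynomial.X - h.map MvPolynomial.C).map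
      (dualEval A δ : Functions g →+* DualNumber ℂ) =
        dualPoly (momentMap g A - h) (momentMapDeriv g A δ) := by
    rw [Polynomial.map_sub, momentMap_map_dualEval, map_dualEval_map_C]
    simp only [dualPoly, Polynomial.map_sub]
    ring
  refine ⟨δ, funext ?_⟩
  rintro (j | j | j | j) <;> dsimp only [stratumEquation]
  · rw [snd_dualEval_coeff (map_dualEval_modByMonic F.monic (uPoly_map_dualEval g A δ)), hu, hrt]
  · rw [snd_dualEval_coeff (map_dualEval_modByMonic F.monic (vPoly_map_dualEval g A δ)), hv, hst]
  · rw [snd_dualEval_coeff (map_dualEval_modByMonic F.monic (wPoly_map_dualEval g A δ)), hw, hqt]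
  · rw [snd_dualEval_coeff (map_dualEval_divByMonic (F.monic.pow 2) hmap), hH, hτt]

end GcdFactorization

theorem isRegularLocalRing_fiberStratum {h : ℂ[X]} (hmonic : h.Monic)
    (hdeg : h.natDegree = 2 * g + 1) {i : ℕ} {A : PhaseSpace g} (hA : A ∈ fiberStratum g i h) :
    IsRegularLocalRing (LocalRing (fiberStratum g i h) A) ∧
      ringKrullDim (LocalRing (fiberStratum g i h) A) = i := by
  obtain ⟨Q, ⟨F⟩⟩ := exists_gcdFactorization A
  have hi := (F.mem_stratum_iff i).1 hA.2
  obtain rfl : F.u.natDegree = i := by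
    have := F.natDegree_add
    omega
  have hQh : Q ^ 2 ∣ h := mem_fiber_iff.1 hA.1 ▸ F.dividesLax.sq_dvd
  obtain ⟨U, hU, hAU, hS⟩ :=
    F.exists_isOpen_forall_mem_fiberStratum_iff (h := h) hmonic.ne_zero hi
  obtain ⟨hreg, hdim⟩ := isRegularLocalRing_localRing_of_surjective hA hU hAU
    (fun B hB => (hS B hB).trans
      (forall_eval_stratumEquation_eq_zero_iff hmonic hdeg F.monic hQh hi B).symm)
    (F.surjective_dualEval_stratumEquation h)
  refine ⟨hreg, ?_⟩
  rw [← hreg.spanFinrank_maximalIdeal] at hdim ⊢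
  simp only [Fintype.card_sum, Fintype.card_fin] at hdim
  norm_cast at hdim ⊢
  omega

end Mumford

end

theorem proposition3p19 (g : ℕ) (h : Polynomial ℂ) (hmonic : h.Monic)
    (hdeg : h.natDegree = 2 * g + 1) (i : ℕ)
    (hne : (Mumford.fiberStratum g i h).Nonempty) :
    ClassicalVariety.IsQuasiAffine (Mumford.fiberStratum g i h) ∧
      ClassicalVariety.IsSmooth (Mumford.fiberStratum g i h) ∧
      ClassicalVariety.IsEquidimensional (Mumford.fiberStratum g i h) i ∧
      ClassicalVariety.dimension (Mumford.fiberStratum g i h) = i := by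
  have hq := Mumford.isQuasiAffine_fiberStratum (g := g) hmonic.ne_zero i
  have hlocal {A : Mumford.PhaseSpace g} (hA : A ∈ Mumford.fiberStratum g i h) :=
    Mumford.isRegularLocalRing_fiberStratum hmonic hdeg hA
  exact ⟨hq, fun _ hA => (hlocal hA).1, fun _ hA => (hlocal hA).2,
    ClassicalVariety.dimension_eq_of_isEquidimensional hq hne fun _ hA => (hlocal hA).2⟩
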